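/- Let $S$ be a finite set of places of $\mathbb Q$ containing the archimedean place $\infty$, let $S_{\mathrm{fin}} = S\setminus\{\infty\}$, and let $\mathbb Z_S = \{x \in \mathbb Q : |x|_p \le 1 \text{ for all primes } p \notin S\}$ be the ring of $S$-integers. Let $G = \prod_{v\in S}\mathrm{SL}_2(\mathbb Q_v)$ (with $\mathbb Q_\infty = \mathbb R$), let $\Gamma = \mathrm{SL}_2(\mathbb Z_S)$, embedded diagonally in $G$, let $H = \prod_{p \in S_{\mathrm{fin}}}\mathrm{SL}_2(\mathbb Z_p)\times \mathrm{SO}_2(\mathbb R) \subset G$, and let $X = \Gamma\backslash G$. Let $\mu_G$ be a Haar measure on $G$ and $\mu_X$ the induced measure on $X$, i.e. the measure that agrees locally with $\mu_G$ under $\pi : G \to X$; equivalently, $\mu_X(A) = \mu_G(\pi^{-1}(A)\cap D)$ for every fundamental domain $D$ for the action of $\Gamma$ on $G$ by left multiplication. Let $(\varphi_n)_{n \in \mathbb N}$ be a sequence of non-negative integrable functions on $G$ such that each $\varphi_n$ has compact support, $\sup_n\|\varphi_n\|_{\infty} < \infty$ (essential supremum norm with respect to $\mu_G$), $\lim_{n\to\infty}\int_G\varphi_n\,\mathrm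 d\mu_G = \infty$, and $\varphi_n(hg) = \varphi_n(g)$ for all $n$, $h \in H$, $g \in G$. Define $F_{\varphi_n} : X \to \mathbb R$ by $$F_{\varphi_n}(\Gamma g) = \sum_{\gamma\in\Gamma}\varphi_n(\gamma g).$$ Then $0 < \mu_X(X) < \infty$, and, with $I_n = \frac{1}{\mu_X(X)}\int_G\varphi_n\,\mathrm d\mu_G$, the functions $F_{\varphi_n}/I_n$ converge weakly to $1$ as $n\to\infty$: for every real-valued continuous function $\alpha$ with compact support on $X$, $$\lim_{n\to\infty}\frac{1}{I_n}\int_X F_{\varphi_n}\,\alpha\,\mathrm d\mu_X = \int_X\alpha\,\mathrm d\mu_X,$$ where all these integrals exist (and $F_{\varphi_n}/I_n$ is read as $0$ for the finitely many $n$ with $I_n = 0$). -/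

import Mathlib

open MeasureTheory Filter Topology
open scoped MatrixGroups CompactlySupported

noncomputable section

namespace SArith

instance factPrime (p : Nat.Primes) : Fact (p.1).Prime := ⟨p.2⟩

/-- The ring `ℤ_S` of `S`-integers, for the set of places of `ℚ` consisting of the archimedean place
and the primes in `S`: the rationals `x` with `|x|_p ≤ 1` for every prime `p` outside `S`. -/
def SInt (S : Finset Nat.Primes) : Subring ℚ where
  carrier := {x | ∀ p : Nat.Primes, p ∉ S → padicNorm p.1 x ≤ 1}
  zero_mem' := fun p _ => by simp
  one_mem' := fun p _ => by simp
  neg_mem' := fun {x} hx p hp => by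
    rw [padicNorm.neg]
    exact hx p hp
  add_mem' := fun {x y} hx hy p hp =>
    padicNorm.nonarchimedean.trans (max_le (hx p hp) (hy p hp))
  mul_mem' := fun {x y} hx hy p hp => by
    rw [padicNorm.mul]
    exact mul_le_one₀ (hx p hp) (padicNorm.nonneg _) (hy p hp)

/-- The `S`-adic Lie group `G = SL₂(ℝ) × ∏_{p ∈ S} SL₂(ℚ_p)`, with the product topology. -/
abbrev G (S : Finset Nat.Primes) : Type :=
  SL(2, ℝ) × ((p : S) → SL(2, ℚ_[p.1.1]))

/-- The diagonal embedding `SL₂(ℤ_S) → G`. -/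
def diag (S : Finset Nat.Primes) : SL(2, SInt S) →* G S :=
  (Matrix.SpecialLinearGroup.map ((algebraMap ℚ ℝ).comp (SInt S).subtype)).prod
    (MonoidHom.pi fun p : S =>
      Matrix.SpecialLinearGroup.map ((algebraMap ℚ ℚ_[p.1.1]).comp (SInt S).subtype))

/-- `Γ = SL₂(ℤ_S)`, diagonally embedded in `G`. -/
def Gam (S : Finset Nat.Primes) : Subgroup (G S) := (diag S).range

/-- `SO₂(ℝ)` as a subgroup of `SL₂(ℝ)`: the `g` with `gᵀ g = 1`. -/
def SO2 : Subgroup SL(2, ℝ) where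
  carrier := {g | g.transpose * g = 1}
  one_mem' := by ext i j; fin_cases i <;> fin_cases j <;> simp
  mul_mem' := fun {a b} ha hb => by
    have h : (a * b).transpose = b.transpose * a.transpose :=
      Subtype.ext (Matrix.transpose_mul a.1 b.1)
    calc (a * b).transpose * (a * b) = b.transpose * (a.transpose * a) * b := by
          rw [h]; simp only [mul_assoc]
      _ = 1 := by rw [ha, mul_one, hb]
  inv_mem' := fun {g} hg => by
    have h1 : g.transpose = g⁻¹ := eq_inv_of_mul_eq_one_left hg
    have h2 : (g⁻¹).transpose = g := by
      rw [← h1]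
      exact Subtype.ext (Matrix.transpose_transpose g.1)
    calc (g⁻¹).transpose * g⁻¹ = g * g⁻¹ := by rw [h2]
      _ = 1 := mul_inv_cancel g

/-- `SL₂(ℤ_p)` as a subgroup of `SL₂(ℚ_p)`. -/
def SLZp (p : ℕ) [Fact p.Prime] : Subgroup SL(2, ℚ_[p]) :=
  (Matrix.SpecialLinearGroup.map (n := Fin 2) (PadicInt.Coe.ringHom (p := p))).range

/-- The compact subgroup `H = ∏_{p ∈ S} SL₂(ℤ_p) × SO₂(ℝ)` of `G`. -/
def H (S : Finset Nat.Primes) : Subgroup (G S) :=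
  SO2.prod (Subgroup.pi Set.univ fun p : S => SLZp p.1.1)

/-- The space `X = Γ \ G` of orbits of `Γ` acting on `G` by left multiplication. It carries the
quotient topology and the quotient `σ`-algebra. -/
abbrev X (S : Finset Nat.Primes) : Type := Quotient (MulAction.orbitRel (Gam S) (G S))

/-- `F_φ(Γ g) = ∑_{γ ∈ Γ} φ(γ g)`, as a function on `X = Γ \ G`. -/
def F (S : Finset Nat.Primes) (φ : G S → ℝ) : X S → ℝ :=
  MulAction.automorphize (α := Gam S) φ

theorem F_mk (S : Finset Nat.Primes) (φ : G S → ℝ) (g : G S) :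
    F S φ (Quotient.mk _ g) = ∑' γ : Gam S, φ (γ * g) := rfl

/-- Weak convergence of the functions `f n` to the function `f`, tested against
`C_c(Y)`: `∫ f n · α dμ → ∫ f · α dμ` for every `α ∈ C_c(Y)`, where all these integrals exist. -/
def ConvergesWeakly {Y : Type*} [TopologicalSpace Y] [MeasurableSpace Y] (μ : Measure Y)
    (f : ℕ → Y → ℝ) (f' : Y → ℝ) : Prop :=
  ∀ α : C_c(Y, ℝ), (∀ n, Integrable (fun x => f n x * α x) μ) ∧
    Integrable (fun x => f' x * α x) μ ∧
    Tendsto (fun n => ∫ x, f n x * α x ∂μ) atTop (𝓝 (∫ x, f' x * α x ∂μ))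

end SArith

end

/-!
Unfolding turns `∫ F_φ α dμ_X` into `∫_G φ(g) α(Γ g) dg`, and as `φ` is left `H`-invariant this
equals `∫_G φ(g) A(g) dg`, where `A(g)` is the average of `α` over `Γ \ Γ H g`. The weights `φ_n`
are uniformly bounded with total mass tending to infinity, so it suffices that `A(g)` tends to the
mean of `α` as `g` leaves every compact subset of `G` (`tendsto_weighted_mean`, `tendsto_avg`).

That is the equidistribution argument of Eskin and McMullen. The action of `G` on `X = Γ \ G` by
right translation is mixing (`tendsto_inner_rightRegular`), which by unfolding says that
`∫_O α(Γ x g) dx` is asymptotically `μ_G(O)` times the mean of `α`, for every relatively compact `O`. For a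
small left `H`-invariant neighbourhood `O` of `H` the wavefront property `O g ⊆ H g V`
(`exists_wavefront`) and the uniform continuity of `α` show that `A(x g)` is uniformly close to
`A(g)` for `x ∈ O`, and the integrals of `A(x g)` and of `α(Γ x g)` over `O` agree.

Mixing is proved by the Howe–Moore argument. Along an ultrafilter leaving compact sets, some
component of `g` goes to infinity, and a weak limit of `ρ(g) α` in `L²(X)` is fixed by a
nontrivial unipotent subgroup of the corresponding factor `SL₂(ℚ_v)` (`exists_fixed_weak_limit`),
hence by the whole factor (Mautner phenomenon, `fixed_of_upper_fixed`). By strong approximation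
(`dense_real`, `dense_padic`) each factor has dense product with `Γ`, so that it acts ergodically
on `X` (`exists_ae_eq_const_of_invariant`), and the weak limit is constant.

The volume of `X` is finite since a Siegel set, integral at the primes in `S`, meets every
`Γ`-orbit, by strong approximation and the reduction theory of `SL₂(ℤ)`, and has finite measure
(`measure_siegelPiece_lt_top`). A group with a discrete subgroup of finite covolume is unimodular
(`isMulRightInvariant_of_finite`), which makes the right action measure preserving.
-/

noncomputable section

set_option linter.unusedSectionVars false

namespace LatticeQuotient

/-- The space `Γ \ G` of orbits of a subgroup `Γ` acting on `G` by left multiplication. -/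
abbrev LeftQuotient {G : Type*} [Group G] (Γ : Subgroup G) : Type _ :=
  Quotient (MulAction.orbitRel Γ G)

/-- The projection `G → Γ \ G`. -/
abbrev proj {G : Type*} [Group G] (Γ : Subgroup G) (g : G) : LeftQuotient Γ :=
  Quotient.mk (MulAction.orbitRel Γ G) g

/-! ### The quotient by a discrete subgroup -/

section Algebra

variable {G : Type*} [Group G] {Γ : Subgroup G}

theorem proj_smul (γ : Γ) (g : G) : proj Γ (γ * g) = proj Γ g :=
  Quotient.sound ⟨γ, rfl⟩

theorem proj_eq_iff {g h : G} : proj Γ g = proj Γ h ↔ ∃ γ : Γ, (γ : G) * h = g :=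
  Quotient.eq.trans Iff.rfl

/-- Right translation by `g` on `Γ \ G`. -/
def rightTranslate (g : G) : LeftQuotient Γ → LeftQuotient Γ :=
  Quotient.map (· * g) fun a b ⟨γ, h⟩ => ⟨γ, by
    rw [← h]; exact (mul_assoc (γ : G) b g).symm⟩

@[simp]
theorem rightTranslate_proj (g x : G) : rightTranslate g (proj Γ x) = proj Γ (x * g) := rfl

theorem automorphize_proj (f : G → ℝ) (g : G) :
    (MulAction.automorphize f : LeftQuotient Γ → ℝ) (proj Γ g) = ∑' γ : Γ, f (γ * g) := rfl

theorem automorphize_mul_comp_proj (f : G → ℝ) (α : LeftQuotient Γ → ℝ) :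
    (MulAction.automorphize fun g => f g * α (proj Γ g)) =
      fun x : LeftQuotient Γ => MulAction.automorphize f x * α x := by
  funext x
  induction x using Quotient.inductionOn with
  | h g =>
    change ∑' γ : Γ, f (γ * g) * α (proj Γ (γ * g)) = (∑' γ : Γ, f (γ * g)) * α (proj Γ g)
    simp only [proj_smul]
    exact tsum_mul_right

end Algebra

section Topology

variable {G : Type*} [Group G] [TopologicalSpace G] [IsTopologicalGroup G]

theorem finite_inter_compact [T2Space G] {Γ : Subgroup G} [DiscreteTopology Γ] {K : Set G}
    (hK : IsCompact K) : {γ : Γ | (γ : G) ∈ K}.Finite := by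
  have h := Γ.tendsto_coe_cofinite_of_discrete (isDiscrete_iff_discreteTopology.mpr ‹_›)
    hK.compl_mem_cocompact
  rw [mem_map, mem_cofinite, Set.preimage_compl, compl_compl] at h
  exact h

variable [PolishSpace G] (Γ : Subgroup G) [DiscreteTopology Γ]

instance properlyDiscontinuousSMul : ProperlyDiscontinuousSMul Γ G :=
  Γ.properlyDiscontinuousSMul_of_tendsto_cofinite
    (Γ.tendsto_coe_cofinite_of_discrete (isDiscrete_iff_discreteTopology.mpr ‹_›))

instance countable_of_discrete : Countable Γ := countable_of_Lindelof_of_discrete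

instance secondCountable_leftQuotient : SecondCountableTopology (LeftQuotient Γ) :=
  ContinuousConstSMul.secondCountableTopology

instance locallyCompact_leftQuotient [LocallyCompactSpace G] :
    LocallyCompactSpace (LeftQuotient Γ) :=
  MulAction.isOpenQuotientMap_quotientMk.locallyCompactSpace

theorem continuous_proj : Continuous (proj Γ) := continuous_quot_mk

theorem continuous_rightTranslate_uncurry :
    Continuous fun p : G × LeftQuotient Γ => rightTranslate p.1 p.2 := by
  have hq : IsOpenQuotientMap (Prod.map id (proj Γ) : G × G → G × LeftQuotient Γ) :=
    IsOpenQuotientMap.id.prodMap MulAction.isOpenQuotientMap_quotientMk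
  rw [hq.isQuotientMap.continuous_iff]
  exact (continuous_proj Γ).comp (continuous_snd.mul continuous_fst)

theorem continuous_rightTranslate (g : G) :
    Continuous (rightTranslate g : LeftQuotient Γ → LeftQuotient Γ) :=
  (continuous_rightTranslate_uncurry Γ).comp (Continuous.prodMk_right g)

theorem exists_open_separating :
    ∃ U : Set G, IsOpen U ∧ (1 : G) ∈ U ∧ ∀ x ∈ U, ∀ y ∈ U, x * y⁻¹ ∈ Γ → x = y := by
  obtain ⟨V, hV, hVΓ⟩ := nhds_inter_eq_singleton_of_mem_discrete
    (isDiscrete_iff_discreteTopology.mpr ‹DiscreteTopology Γ›) Γ.one_mem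
  have hc : Tendsto (fun p : G × G => p.1 * p.2⁻¹) (𝓝 (1, 1)) (𝓝 1) :=
    (continuous_fst.mul continuous_snd.inv).tendsto' _ _ (by simp)
  have h2 := hc hV
  rw [nhds_prod_eq, mem_map, mem_prod_same_iff] at h2
  obtain ⟨t, ht, htV⟩ := h2
  obtain ⟨U, hUt, hU, h1⟩ := mem_nhds_iff.1 ht
  refine ⟨U, hU, h1, fun x hx y hy hxy => ?_⟩
  have h3 : x * y⁻¹ ∈ V ∩ Γ := ⟨htV (Set.mk_mem_prod (hUt hx) (hUt hy)), hxy⟩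
  rw [hVΓ] at h3
  exact mul_inv_eq_one.1 h3

end Topology

/-! ### Invariant measures and unfolding -/

section Measure

variable {G : Type*} [Group G] [TopologicalSpace G] [IsTopologicalGroup G] [PolishSpace G]
  [MeasurableSpace G] [BorelSpace G] (Γ : Subgroup G) [DiscreteTopology Γ]

/-- A Borel set of representatives for `Γ \ G`: cut countably many small open sets covering `G`
down so that they meet every orbit exactly once. -/
theorem exists_measurable_transversal :
    ∃ D : Set G, MeasurableSet D ∧ ∀ x : G, ∃! γ : Γ, γ • x ∈ D := by
  obtain ⟨U, hU, h1, hsep⟩ := exists_open_separating Γ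
  let d : ℕ → G := TopologicalSpace.denseSeq G
  let W : ℕ → Set G := fun n => {x | x * (d n)⁻¹ ∈ U}
  have hW : ∀ n, IsOpen (W n) := fun n => hU.preimage (continuous_mul_const _)
  have hcov : ∀ x : G, ∃ n, x ∈ W n := fun x => by
    have ho : IsOpen {g : G | x * g⁻¹ ∈ U} := hU.preimage (continuous_const.mul continuous_inv)
    obtain ⟨n, hn⟩ := (TopologicalSpace.denseRange_denseSeq G).exists_mem_open ho
      ⟨x, by simpa using h1⟩
    exact ⟨n, hn⟩
  let V : ℕ → Set G := fun n => ⋃ γ : Γ, (fun x => (γ : G) * x) ⁻¹' W n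
  have hV : ∀ n, IsOpen (V n) := fun n =>
    isOpen_iUnion fun γ => (hW n).preimage (continuous_const_mul _)
  have hVinv : ∀ n (γ : Γ) x, (γ : G) * x ∈ V n ↔ x ∈ V n := fun n γ x => by
    simp only [V, Set.mem_iUnion, Set.mem_preimage]
    constructor
    · rintro ⟨δ, h⟩
      exact ⟨δ * γ, by simpa [mul_assoc] using h⟩
    · rintro ⟨δ, h⟩
      exact ⟨δ * γ⁻¹, by simpa [mul_assoc] using h⟩
  have hWV : ∀ n, W n ⊆ V n := fun n x hx => Set.mem_iUnion.2 ⟨1, by simpa using hx⟩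
  refine ⟨⋃ n, W n ∩ ⋂ m, ⋂ _ : m < n, (V m)ᶜ, ?_, fun x => ?_⟩
  · exact .iUnion fun n => (hW n).measurableSet.inter
      (.iInter fun m => .iInter fun _ => (hV m).measurableSet.compl)
  · classical
    have hx : ∃ n, x ∈ V n := (hcov x).imp fun n hn => hWV n hn
    obtain ⟨γ, hγ⟩ := Set.mem_iUnion.1 (Nat.find_spec hx)
    have key : ∀ δ : Γ, (δ • x ∈ ⋃ n, W n ∩ ⋂ m, ⋂ _ : m < n, (V m)ᶜ) →
        (δ : G) * x ∈ W (Nat.find hx) := fun δ hδ => by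
      obtain ⟨n, hn, hn'⟩ := Set.mem_iUnion.1 hδ
      simp only [Set.mem_iInter, Set.mem_compl_iff] at hn'
      have : Nat.find hx = n := by
        rw [Nat.find_eq_iff]
        refine ⟨(hVinv n δ x).1 (hWV n hn), fun m hm h => hn' m hm ((hVinv m δ x).2 h)⟩
      rw [this]; exact hn
    refine ⟨γ, Set.mem_iUnion.2 ⟨Nat.find hx, hγ, ?_⟩, fun δ hδ => ?_⟩
    · simp only [Set.mem_iInter, Set.mem_compl_iff]
      exact fun m hm h => Nat.find_min hx hm ((hVinv m γ x).1 h)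
    · have := hsep _ (key δ hδ) _ hγ (by
        have : (δ : G) * x * (d (Nat.find hx))⁻¹ * ((γ : G) * x * (d (Nat.find hx))⁻¹)⁻¹
          = δ * (γ : G)⁻¹ := by group
        rw [this]; exact Γ.mul_mem δ.2 (Γ.inv_mem γ.2))
      simpa using this

variable {Γ} (μ : Measure G) [μ.IsHaarMeasure]

theorem isFundamentalDomain_of_transversal {D : Set G} (hD : MeasurableSet D)
    (hD' : ∀ x : G, ∃! γ : Γ, γ • x ∈ D) : IsFundamentalDomain Γ D μ :=
  IsFundamentalDomain.mk' hD.nullMeasurableSet hD'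

theorem transversal_preimage_mul_right {D : Set G} (hD : MeasurableSet D)
    (hD' : ∀ x : G, ∃! γ : Γ, γ • x ∈ D) (g : G) :
    MeasurableSet ((· * g) ⁻¹' D) ∧ ∀ x : G, ∃! γ : Γ, γ • x ∈ (· * g) ⁻¹' D := by
  refine ⟨hD.preimage (measurable_mul_const g), fun x => ?_⟩
  obtain ⟨γ, hγ, hu⟩ := hD' (x * g)
  refine ⟨γ, ?_, fun δ hδ => hu δ ?_⟩
  · simpa [Subgroup.smul_def, mul_assoc] using hγ
  · simpa [Subgroup.smul_def, mul_assoc] using hδ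

variable (μX : Measure (LeftQuotient Γ)) [QuotientMeasureEqMeasurePreimage μ μX]

theorem measurable_proj : Measurable (proj Γ) :=
  measurable_quotient_mk' (s := MulAction.orbitRel Γ G)

include μ in
theorem measure_univ_ne_zero : μX Set.univ ≠ 0 := by
  obtain ⟨D, hD, hD'⟩ := exists_measurable_transversal Γ
  have hf := isFundamentalDomain_of_transversal μ hD hD'
  rw [hf.projection_respects_measure_apply (μ := μX) MeasurableSet.univ]
  simpa using hf.measure_ne_zero (NeZero.ne μ)

theorem measure_univ_le {E : Set G} (hE : ∀ g : G, ∃ γ : Γ, (γ : G) * g ∈ E) :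
    μX Set.univ ≤ μ E := by
  obtain ⟨D, hD, hD'⟩ := exists_measurable_transversal Γ
  have hf := isFundamentalDomain_of_transversal μ hD hD'
  rw [hf.projection_respects_measure_apply (μ := μX) MeasurableSet.univ, hf.measure_eq_tsum E]
  refine le_trans (measure_mono fun x hx => ?_) (measure_iUnion_le _)
  obtain ⟨γ, hγ⟩ := hE x
  refine Set.mem_iUnion.2 ⟨γ⁻¹, ?_, hx.2⟩
  exact ⟨γ * x, hγ, by simp [Subgroup.smul_def]⟩

include μ in
/-- A group containing a discrete subgroup of finite covolume is unimodular: a right translate of a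
fundamental domain is again one, so right translations do not change its (finite, positive)
volume. -/
theorem isMulRightInvariant_of_finite [LocallyCompactSpace G] (hfin : μX Set.univ ≠ ⊤) :
    μ.IsMulRightInvariant := by
  obtain ⟨D, hD, hD'⟩ := exists_measurable_transversal Γ
  have hf := isFundamentalDomain_of_transversal μ hD hD'
  have hDX : μX Set.univ = μ D := by
    rw [hf.projection_respects_measure_apply (μ := μX) MeasurableSet.univ]; simp
  refine ⟨fun g => ?_⟩
  have : (Measure.map (· * g) μ).IsHaarMeasure := inferInstance
  have hs := Measure.isMulLeftInvariant_eq_smul (Measure.map (· * g) μ) μ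
  obtain ⟨hD1, hD2⟩ := transversal_preimage_mul_right hD hD' g
  have hf2 := isFundamentalDomain_of_transversal μ hD1 hD2
  have he : Measure.map (· * g) μ D = μ D := by
    rw [Measure.map_apply (measurable_mul_const g) hD]
    exact hf2.measure_eq hf
  set c := (Measure.map (· * g) μ).haarScalarFactor μ
  have hc : (c : ENNReal) * μ D = μ D := by
    conv_rhs => rw [← he, hs]
    rfl
  have hc1 : (c : ENNReal) = 1 := by
    rw [ENNReal.mul_eq_right (hDX ▸ measure_univ_ne_zero μ μX) (hDX ▸ hfin)] at hc
    exact hc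
  rw [hs, show c = 1 by exact_mod_cast hc1, one_smul]

/-- A property of points of `Γ \ G` that holds at the images of almost all points of `G` holds
almost everywhere. -/
theorem ae_of_ae_proj {P : LeftQuotient Γ → Prop} (h : ∀ᵐ g ∂μ, P (proj Γ g)) : ∀ᵐ x ∂μX, P x := by
  obtain ⟨D, hD, hD'⟩ := exists_measurable_transversal Γ
  have hf := isFundamentalDomain_of_transversal μ hD hD'
  set N := toMeasurable μ {g | ¬ P (proj Γ g)}
  have hN : μ N = 0 := by rw [measure_toMeasurable]; exact h
  have hm : MeasurableSet (proj Γ '' Nᶜ) := by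
    change MeasurableSet (proj Γ ⁻¹' (proj Γ '' Nᶜ))
    have : proj Γ ⁻¹' (proj Γ '' Nᶜ) = ⋃ γ : Γ, (fun x => (γ : G) * x) ⁻¹' Nᶜ := by
      ext x
      simp only [Set.mem_preimage, Set.mem_image, Set.mem_iUnion]
      constructor
      · rintro ⟨y, hy, hxy⟩
        obtain ⟨γ, rfl⟩ := proj_eq_iff.1 hxy
        exact ⟨γ, hy⟩
      · rintro ⟨γ, hγ⟩
        exact ⟨_, hγ, proj_smul γ x⟩
    rw [this]
    exact .iUnion fun γ =>
      ((measurableSet_toMeasurable _ _).compl).preimage (measurable_const_mul _)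
  refine measure_mono_null (t := (proj Γ '' Nᶜ)ᶜ) ?_ ?_
  · rintro x hx ⟨g, hg, rfl⟩
    exact hg (subset_toMeasurable _ _ hx)
  · rw [hf.projection_respects_measure_apply (μ := μX) hm.compl]
    refine measure_mono_null (fun g hg => ?_) hN
    by_contra hgN
    exact hg.1 ⟨g, hgN, rfl⟩

/-- Conversely, null sets of `Γ \ G` have null preimage. -/
theorem ae_proj_of_ae {P : LeftQuotient Γ → Prop} (h : ∀ᵐ x ∂μX, P x) : ∀ᵐ g ∂μ, P (proj Γ g) := by
  obtain ⟨D, hD, hD'⟩ := exists_measurable_transversal Γ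
  have hf := isFundamentalDomain_of_transversal μ hD hD'
  set N := toMeasurable μX {x | ¬ P x}
  have hN : μX N = 0 := by rw [measure_toMeasurable]; exact h
  rw [hf.projection_respects_measure_apply (μ := μX) (measurableSet_toMeasurable _ _)] at hN
  have h0 : μ (proj Γ ⁻¹' N) = 0 := by
    refine hf.measure_zero_of_invariant _ (fun γ => ?_) hN
    ext x
    rw [Set.mem_smul_set_iff_inv_smul_mem, Set.mem_preimage, Set.mem_preimage]
    exact iff_of_eq (congrArg (· ∈ N) (proj_smul γ⁻¹ x))
  refine measure_mono_null (t := proj Γ ⁻¹' N) (fun g hg => ?_) h0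
  exact subset_toMeasurable μX {x | ¬ P x} hg

theorem measurable_automorphize {f : G → ℝ} (hf : Measurable f) (h0 : ∀ g, 0 ≤ f g) :
    Measurable (MulAction.automorphize f : LeftQuotient Γ → ℝ) := by
  refine measurable_from_quotient.2 ?_
  have : (fun g : G => ∑' γ : Γ, f (γ * g)) =
      fun g => (∑' γ : Γ, ENNReal.ofReal (f (γ * g))).toReal := by
    funext g
    rw [ENNReal.tsum_toReal_eq (fun _ => ENNReal.ofReal_ne_top)]
    exact tsum_congr fun γ => (ENNReal.toReal_ofReal (h0 _)).symm
  change Measurable fun g : G => ∑' γ : Γ, f (γ * g)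
  rw [this]
  exact (Measurable.tsum fun γ =>
    (hf.comp (measurable_const_mul _)).ennreal_ofReal).ennreal_toReal

theorem aestronglyMeasurable_automorphize {f : G → ℝ} (hf : AEStronglyMeasurable f μ)
    (h0 : ∀ g, 0 ≤ f g) :
    AEStronglyMeasurable (MulAction.automorphize f : LeftQuotient Γ → ℝ) μX := by
  obtain ⟨f', hf', hff'⟩ := hf.aemeasurable
  refine ⟨MulAction.automorphize fun g => max (f' g) 0,
    (measurable_automorphize (hf'.max measurable_const) fun _ =>
      le_max_right _ _).stronglyMeasurable,
    ae_of_ae_proj μ μX ?_⟩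
  have h2 : ∀ᵐ g ∂μ, ∀ γ : Γ, f (γ * g) = f' (γ * g) := ae_all_iff.2 fun γ =>
    (measurePreserving_mul_left μ (γ : G)).quasiMeasurePreserving.ae hff'
  filter_upwards [h2] with g hg
  rw [automorphize_proj, automorphize_proj]
  refine tsum_congr fun γ => ?_
  rw [← hg γ, max_eq_left (h0 _)]

theorem integral_automorphize {f : G → ℝ} (hf : Integrable f μ)
    (hF : AEStronglyMeasurable (MulAction.automorphize f : LeftQuotient Γ → ℝ) μX) :
    Integrable (MulAction.automorphize f : LeftQuotient Γ → ℝ) μX ∧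
      ∫ x, (MulAction.automorphize f : LeftQuotient Γ → ℝ) x ∂μX = ∫ g, f g ∂μ := by
  obtain ⟨D, hD, hD'⟩ := exists_measurable_transversal Γ
  have hfd := isFundamentalDomain_of_transversal μ hD hD'
  have hX := hfd.projection_respects_measure (μ := μX)
  have hfin : ∑' γ : Γ, ∫⁻ x in D, ‖f (γ • x)‖ₑ ∂μ ≠ ⊤ := by
    rw [← hfd.lintegral_eq_tsum'' (‖f ·‖ₑ)]
    exact ne_of_lt hf.2
  have hm : ∀ γ : Γ, AEStronglyMeasurable (fun x => f (γ • x)) (μ.restrict D) := fun γ =>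
    (hf.1.comp_quasiMeasurePreserving
      (measurePreserving_smul γ μ).quasiMeasurePreserving).restrict
  rw [hX] at hF ⊢
  constructor
  · rw [integrable_map_measure hF (measurable_proj).aemeasurable]
    refine ⟨hF.comp_measurable measurable_proj, ?_⟩
    refine lt_of_le_of_lt (lintegral_mono fun x =>
      (enorm_tsum_le_tsum_enorm : ‖∑' γ : Γ, f (γ • x)‖ₑ ≤ _)) ?_
    rw [lintegral_tsum fun γ => (hm γ).enorm]
    exact hfin.lt_top
  · rw [integral_map measurable_proj.aemeasurable hF, hfd.integral_eq_tsum'' f hf,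
      ← integral_tsum hm hfin]
    rfl

/-- The unfolding identity `∫_{Γ \ G} F_f α = ∫_G f · (α ∘ π)` for nonnegative integrable `f` and
bounded measurable `α`. -/
theorem unfolding {f : G → ℝ} (hf : Integrable f μ) (h0 : ∀ g, 0 ≤ f g)
    {α : LeftQuotient Γ → ℝ} (hα : Measurable α) {C : ℝ} (hC : ∀ x, |α x| ≤ C) :
    Integrable (fun x : LeftQuotient Γ => MulAction.automorphize f x * α x) μX ∧
      ∫ x : LeftQuotient Γ, MulAction.automorphize f x * α x ∂μX =
        ∫ g, f g * α (proj Γ g) ∂μ := by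
  have hi : Integrable (fun g => f g * α (proj Γ g)) μ :=
    hf.mul_bdd (c := C) (hα.comp measurable_proj).aestronglyMeasurable
      (ae_of_all _ fun g => hC _)
  rw [← automorphize_mul_comp_proj]
  refine integral_automorphize μ μX hi ?_
  rw [automorphize_mul_comp_proj]
  exact (aestronglyMeasurable_automorphize μ μX hf.1 h0).mul hα.aestronglyMeasurable

theorem measurePreserving_rightTranslate [μ.IsMulRightInvariant] [LocallyCompactSpace G] (g : G) :
    MeasurePreserving (rightTranslate g : LeftQuotient Γ → LeftQuotient Γ) μX μX := by
  refine ⟨(continuous_rightTranslate Γ g).measurable, ?_⟩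
  obtain ⟨D, hD, hD'⟩ := exists_measurable_transversal Γ
  have hf := isFundamentalDomain_of_transversal μ hD hD'
  obtain ⟨hD1, hD2⟩ := transversal_preimage_mul_right hD hD' g
  have hf2 := isFundamentalDomain_of_transversal μ hD1 hD2
  conv_lhs => rw [hf2.projection_respects_measure (μ := μX)]
  rw [hf.projection_respects_measure (μ := μX), Measure.map_map
    (continuous_rightTranslate Γ g).measurable measurable_proj]
  have : (rightTranslate g : LeftQuotient Γ → LeftQuotient Γ) ∘ proj Γ = proj Γ ∘ (· * g) := rfl
  change Measure.map ((rightTranslate g : LeftQuotient Γ → LeftQuotient Γ) ∘ proj Γ) _ = _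
  rw [this, ← Measure.map_map measurable_proj (measurable_mul_const g),
    ((measurePreserving_mul_right μ g).restrict_preimage hD).map_eq]

end Measure

end LatticeQuotient

namespace LatticeQuotient

/-! ### The right regular representation -/

section Representation

variable {G : Type*} [Group G] [TopologicalSpace G] [IsTopologicalGroup G] [PolishSpace G]
  [LocallyCompactSpace G] [MeasurableSpace G] [BorelSpace G] {Γ : Subgroup G} [DiscreteTopology Γ]
  (μ : Measure G) [μ.IsHaarMeasure] [μ.IsMulRightInvariant]
  (μX : Measure (LeftQuotient Γ)) [QuotientMeasureEqMeasurePreimage μ μX]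

/-- The right regular representation `(ρ(g) f)(x) = f(x g)` of `G` on `L²(Γ \ G)`. -/
def rightRegular : G →* (Lp ℝ 2 μX →L[ℝ] Lp ℝ 2 μX) where
  toFun g := (Lp.compMeasurePreservingₗᵢ ℝ (rightTranslate g)
    (measurePreserving_rightTranslate μ μX g)).toContinuousLinearMap
  map_one' := by
    ext1 f
    refine Lp.ext ((Lp.coeFn_compMeasurePreserving f _).trans (ae_of_all _ fun x => ?_))
    induction x using Quotient.inductionOn with
    | h g =>
      change f (proj Γ (g * 1)) = f (proj Γ g)
      rw [mul_one]
  map_mul' g h := by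
    ext1 f
    refine Lp.ext ((Lp.coeFn_compMeasurePreserving f _).trans (EventuallyEq.symm ?_))
    refine (Lp.coeFn_compMeasurePreserving _ (measurePreserving_rightTranslate μ μX g)).trans ?_
    filter_upwards [(measurePreserving_rightTranslate μ μX g).quasiMeasurePreserving.ae
      (Lp.coeFn_compMeasurePreserving f (measurePreserving_rightTranslate μ μX h))] with x hx
    refine hx.trans ?_
    induction x using Quotient.inductionOn with
    | h y =>
      change f (proj Γ (y * g * h)) = f (proj Γ (y * (g * h)))
      rw [mul_assoc]

theorem rightRegular_coeFn (g : G) (f : Lp ℝ 2 μX) :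
    rightRegular μ μX g f =ᵐ[μX] fun x => f (rightTranslate g x) :=
  Lp.coeFn_compMeasurePreserving f _

theorem norm_rightRegular (g : G) (f : Lp ℝ 2 μX) : ‖rightRegular μ μX g f‖ = ‖f‖ :=
  Lp.norm_compMeasurePreserving f _

theorem continuous_rightRegular [IsFiniteMeasure μX] (f : Lp ℝ 2 μX) :
    Continuous fun g => rightRegular μ μX g f := by
  have hc : Continuous fun g : G =>
      (⟨rightTranslate g, continuous_rightTranslate Γ g⟩ : C(LeftQuotient Γ, LeftQuotient Γ)) :=
    (ContinuousMap.mk (fun p : G × LeftQuotient Γ => rightTranslate p.1 p.2)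
      (continuous_rightTranslate_uncurry Γ)).curry.continuous
  exact (continuous_const (y := f)).compMeasurePreservingLp hc
    (fun g => measurePreserving_rightTranslate μ μX g) (by simp)

end Representation

/-! ### Ergodicity from density -/

section Ergodicity

variable {G : Type*} [Group G] [TopologicalSpace G] [IsTopologicalGroup G] [PolishSpace G]
  [LocallyCompactSpace G] [MeasurableSpace G] [BorelSpace G]
  (μ : Measure G) [μ.IsHaarMeasure]

/-- The left translations that preserve a measurable set up to null sets form a closed set: for `t`
of finite measure, `h ↦ μ (s ∩ h⁻¹ t)` is continuous. -/
theorem preimage_ae_eq_of_dense {s : Set G} (hs : MeasurableSet s)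
    (hd : Dense {h : G | (h * ·) ⁻¹' s =ᵐ[μ] s}) (h : G) : (h * ·) ⁻¹' s =ᵐ[μ] s := by
  have hmp := fun h : G => measurePreserving_mul_left μ h
  have hreal : ∀ t, MeasurableSet t → μ t ≠ ⊤ → ∀ h : G,
      μ.real (s ∩ (h * ·) ⁻¹' t) = μ.real (s ∩ t) := fun t ht htm => by
    have hc : Continuous fun h : G => μ.real (s ∩ (h * ·) ⁻¹' t) := by
      have hcm : Continuous fun h : G => (⟨(h * ·), continuous_const_mul h⟩ : C(G, G)) :=
        (ContinuousMap.mk (fun p : G × G => p.1 * p.2) continuous_mul).curry.continuous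
      have h1 := (continuous_const (y := indicatorConstLp 1 ht htm (1 : ℝ))).compMeasurePreservingLp
        hcm hmp (by simp)
      convert (continuous_setIntegral s).comp h1 using 2 with h
      simp only [Function.comp_apply, ContinuousMap.coe_mk]
      rw [Lp.indicatorConstLp_compMeasurePreserving, setIntegral_indicatorConstLp hs,
        Set.inter_comm, smul_eq_mul, mul_one]
    have := hc.ext_on hd continuous_const (g := fun _ => μ.real (s ∩ t)) fun h hh => by
      have h1 : (s ∩ (h * ·) ⁻¹' t : Set G) =ᵐ[μ] (h * ·) ⁻¹' (s ∩ t) :=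
        EventuallyEq.inter (EventuallyEq.symm hh) .rfl
      change μ.real (s ∩ (h * ·) ⁻¹' t) = μ.real (s ∩ t)
      rw [measureReal_congr h1, measureReal_def,
        (hmp h).measure_preimage (hs.inter ht).nullMeasurableSet, measureReal_def]
    exact fun h => congrFun this h
  -- comparing `s` and its translate inside sets of finite measure
  have key : ∀ t, MeasurableSet t → μ t ≠ ⊤ → μ ((h * ·) ⁻¹' s ∩ t) = μ (s ∩ t) :=
      fun t ht htm => by
    have ht' : MeasurableSet ((h⁻¹ * ·) ⁻¹' t) := ht.preimage (measurable_const_mul _)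
    have htm' : μ ((h⁻¹ * ·) ⁻¹' t) ≠ ⊤ := by
      rwa [(hmp h⁻¹).measure_preimage ht.nullMeasurableSet]
    have h1 := hreal _ ht' htm' h
    have h2 : (h * ·) ⁻¹' ((h⁻¹ * ·) ⁻¹' t) = t := by ext x; simp
    rw [h2] at h1
    have h3 : (h * ·) ⁻¹' s ∩ t = (h * ·) ⁻¹' (s ∩ (h⁻¹ * ·) ⁻¹' t) := by
      rw [Set.preimage_inter, h2]
    rw [h3, (hmp h).measure_preimage (hs.inter ht').nullMeasurableSet,
      ← ENNReal.toReal_eq_toReal_iff' (measure_inter_ne_top_of_right_ne_top htm')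
        (measure_inter_ne_top_of_right_ne_top htm)]
    exact h1.symm
  have hsub : ∀ A B : Set G, MeasurableSet A → MeasurableSet B →
      (∀ t, MeasurableSet t → μ t ≠ ⊤ → μ (A ∩ t) = μ (B ∩ t)) → A ≤ᵐ[μ] B := by
    intro A B hA hB hAB
    rw [ae_le_set]
    have hu : A \ B = ⋃ n, (A \ B) ∩ spanningSets μ n := by
      rw [← Set.inter_iUnion, iUnion_spanningSets, Set.inter_univ]
    rw [hu, measure_iUnion_null_iff]
    intro n
    have h1 := hAB ((A \ B) ∩ spanningSets μ n)
      ((hA.diff hB).inter (measurableSet_spanningSets μ n))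
      (measure_inter_ne_top_of_right_ne_top (measure_spanningSets_lt_top μ n).ne)
    have h2 : A ∩ ((A \ B) ∩ spanningSets μ n) = (A \ B) ∩ spanningSets μ n := by
      ext x; simp; tauto
    have h3 : B ∩ ((A \ B) ∩ spanningSets μ n) = ∅ := by
      ext x; simp; tauto
    rw [h2, h3, measure_empty] at h1
    exact h1
  have hA : MeasurableSet ((h * ·) ⁻¹' s) := hs.preimage (measurable_const_mul _)
  exact (hsub _ _ hA hs key).antisymm (hsub _ _ hs hA fun t ht htm => (key t ht htm).symm)

/-- If a measurable set is invariant up to null sets under the right translations by a subgroup,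
the image of `ι`, that is stable under conjugation, then it is so under left translations. -/
theorem preimage_mul_left_ae_eq {K : Type*} [Group K] [TopologicalSpace K] [IsTopologicalGroup K]
    [PolishSpace K] [LocallyCompactSpace K] (ι : K →* G) (hι : Continuous ι)
    (hconj : ∀ g k, ∃ k', g⁻¹ * ι k * g = ι k') {s : Set G} (hs : MeasurableSet s)
    (hr : ∀ k, (· * ι k) ⁻¹' s =ᵐ[μ] s) (k : K) : (ι k * ·) ⁻¹' s =ᵐ[μ] s := by
  borelize K
  let ν : Measure K := Measure.haar
  have h1 : ∀ᵐ g ∂μ, ∀ᵐ u ∂ν, (g * ι u ∈ s ↔ g ∈ s) := by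
    rw [Measure.ae_ae_comm]
    · exact ae_of_all _ fun u => (hr u).mem_iff
    · exact (((hs.preimage (continuous_fst.mul (hι.comp continuous_snd)).measurable).mem).iff
        (hs.preimage measurable_fst).mem).setOf
  have h2 := (measurePreserving_mul_left μ (ι k)).quasiMeasurePreserving.ae h1
  rw [eventuallyEq_set]
  filter_upwards [h1, h2] with g hg hg'
  obtain ⟨k', hk'⟩ := hconj g k
  have h3 := (measurePreserving_mul_left ν k').quasiMeasurePreserving.ae hg
  obtain ⟨u, hu, hu'⟩ := (hg'.and h3).exists
  have : ι k * g * ι u = g * ι (k' * u) := by rw [map_mul, ← hk']; group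
  rw [Set.mem_preimage, ← hu, this, hu']

variable {Γ : Subgroup G} [DiscreteTopology Γ] [μ.IsMulRightInvariant]
  (μX : Measure (LeftQuotient Γ)) [QuotientMeasureEqMeasurePreimage μ μX] [IsFiniteMeasure μX]

/-- Moore's duality: if `Γ N` is dense in `G` for the normal subgroup `N = ι(K)`, then `N` acts
ergodically on `Γ \ G`. -/
theorem exists_ae_eq_const_of_invariant {K : Type*} [Group K] [TopologicalSpace K]
    [IsTopologicalGroup K]
    [PolishSpace K] [LocallyCompactSpace K] (ι : K →* G) (hι : Continuous ι)
    (hconj : ∀ g k, ∃ k', g⁻¹ * ι k * g = ι k')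
    (hdense : (Γ ⊔ ι.range).topologicalClosure = ⊤) (f : Lp ℝ 2 μX)
    (hf : ∀ k, rightRegular μ μX (ι k) f = f) : ∃ c : ℝ, f =ᵐ[μX] fun _ => c := by
  have hm : Measurable fun g => f (proj Γ g) :=
    (Lp.stronglyMeasurable f).measurable.comp measurable_proj
  have hset : ∀ U : Set ℝ, MeasurableSet U →
      EventuallyConst ((fun g => f (proj Γ g)) ⁻¹' U : Set G) (ae μ) := fun U hU => by
    have hs : MeasurableSet ((fun g => f (proj Γ g)) ⁻¹' U) := hm hU
    set s : Set G := (fun g => f (proj Γ g)) ⁻¹' U with hs_def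
    have hr : ∀ k, (· * ι k) ⁻¹' s =ᵐ[μ] s := fun k => by
      have h1 : ∀ᵐ x ∂μX, f (rightTranslate (ι k) x) = f x := by
        have h2 := rightRegular_coeFn μ μX (ι k) f
        rw [hf k] at h2
        exact h2.symm
      rw [eventuallyEq_set]
      filter_upwards [ae_proj_of_ae μ μX h1] with g hg
      change f (rightTranslate (ι k) (proj Γ g)) ∈ U ↔ f (proj Γ g) ∈ U
      rw [hg]
    have hl := preimage_mul_left_ae_eq μ ι hι hconj hs hr
    have hΓ : ∀ γ : Γ, ((γ : G) * ·) ⁻¹' s = s := fun γ => by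
      ext x
      change f (proj Γ (γ * x)) ∈ U ↔ f (proj Γ x) ∈ U
      rw [proj_smul]
    have hle : Γ ⊔ ι.range ≤ MulAction.aestabilizer G μ s := by
      refine sup_le (fun γ hγ => ?_) ?_
      · rw [← inv_mem_iff, MulAction.mem_aestabilizer, ← Set.preimage_smul]
        exact EventuallyEq.of_eq (hΓ ⟨γ, hγ⟩)
      · rintro _ ⟨k, rfl⟩
        rw [← inv_mem_iff, MulAction.mem_aestabilizer, ← Set.preimage_smul]
        exact hl k
    have hd : Dense {h : G | (h * ·) ⁻¹' s =ᵐ[μ] s} := by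
      have h1 : Dense ((Γ ⊔ ι.range : Subgroup G) : Set G) := by
        rw [dense_iff_closure_eq, ← Subgroup.topologicalClosure_coe, hdense, Subgroup.coe_top]
      refine h1.mono fun h hh => ?_
      have h2 := inv_mem (hle hh)
      rw [MulAction.mem_aestabilizer, ← Set.preimage_smul] at h2
      exact h2
    exact aeconst_of_forall_preimage_smul_ae_eq G hs.nullMeasurableSet
      (preimage_ae_eq_of_dense μ hs hd)
  obtain ⟨c, hc⟩ := exists_eventuallyEq_const_of_forall_separating
    (l := ae μ) (f := fun g => f (proj Γ g)) MeasurableSet fun U hU =>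
      eventuallyConst_pred.1 (hset U hU)
  exact ⟨c, ae_of_ae_proj μ μX hc⟩

end Ergodicity

end LatticeQuotient

namespace HoweMoore

/-! ### Unipotent matrices -/

section Unipotent

variable {R : Type*} [CommRing R]

/-- The matrix with rows `(a, b)` and `(c, d)`, as an element of `SL₂`. -/
def mk2 (a b c d : R) (h : a * d - b * c = 1) : SL(2, R) :=
  ⟨!![a, b; c, d], by rw [Matrix.det_fin_two_of, h]⟩

@[simp]
theorem mk2_val (a b c d : R) (h : a * d - b * c = 1) : (mk2 a b c d h).1 = !![a, b; c, d] := rfl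

theorem mul_entry (A B : SL(2, R)) (i j : Fin 2) :
    (A * B).1 i j = A.1 i 0 * B.1 0 j + A.1 i 1 * B.1 1 j := by
  rw [Matrix.SpecialLinearGroup.coe_mul, Matrix.mul_apply, Fin.sum_univ_two]

/-- The upper triangular unipotent matrix with entry `x`. -/
def upperUnip (x : R) : SL(2, R) := mk2 1 x 0 1 (by ring)

/-- The lower triangular unipotent matrix with entry `x`. -/
def lowerUnip (x : R) : SL(2, R) := mk2 1 0 x 1 (by ring)

/-- The unipotent matrix `1 + c v vᵀ J`, where `J` is the standard symplectic form. It fixes `v`,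
and every unipotent matrix fixing `v ≠ 0` is of this form. -/
def unip (c : R) (v : Fin 2 → R) : SL(2, R) :=
  mk2 (1 - c * v 0 * v 1) (c * v 0 ^ 2) (-(c * v 1 ^ 2)) (1 + c * v 0 * v 1) (by ring)

theorem ext2 {A B : SL(2, R)} (h00 : A.1 0 0 = B.1 0 0) (h01 : A.1 0 1 = B.1 0 1)
    (h10 : A.1 1 0 = B.1 1 0) (h11 : A.1 1 1 = B.1 1 1) : A = B := by
  ext i j; fin_cases i <;> fin_cases j <;> assumption

theorem det_eq (A : SL(2, R)) : A 0 0 * A 1 1 - A 0 1 * A 1 0 = 1 := by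
  have := A.det_coe
  rwa [Matrix.det_fin_two] at this

variable {K : Type*} [Field K]

theorem unip_mulVec (A : SL(2, K)) (c : K) (v : Fin 2 → K) :
    A * unip c v = unip c (A.1.mulVec v) * A := by
  have h := det_eq A
  apply ext2 <;> simp only [mul_entry] <;>
    simp [unip, Matrix.mulVec, dotProduct] <;> grind

theorem unip_zero (c : K) : unip c (0 : Fin 2 → K) = 1 := by
  ext i j; fin_cases i <;> fin_cases j <;> simp [unip]

theorem unip_single (c : K) : unip c (Pi.single 0 1) = upperUnip c := by
  ext i j; fin_cases i <;> fin_cases j <;> simp [unip, upperUnip]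

theorem exists_mulVec_eq {v : Fin 2 → K} (hv : v ≠ 0) :
    ∃ B : SL(2, K), B.1.mulVec (Pi.single 0 1) = v := by
  by_cases h0 : v 0 = 0
  · have h1 : v 1 ≠ 0 := fun h1 => hv (by ext i; fin_cases i <;> simp [h0, h1])
    refine ⟨mk2 0 (-(v 1)⁻¹) (v 1) 0 (by simp [h1]), ?_⟩
    ext i; fin_cases i <;> simp [h0]
  · refine ⟨mk2 (v 0) 0 (v 1) (v 0)⁻¹ (by simp [h0]), ?_⟩
    ext i; fin_cases i <;> simp

end Unipotent

/-! ### The Mautner phenomenon -/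

section Mautner

variable {K : Type*} [NontriviallyNormedField K]
  {E : Type*} [NormedAddCommGroup E] [InnerProductSpace ℝ E]
  (ρ : SL(2, K) →* (E →L[ℝ] E))

theorem inner_map_map_of_norm {G : Type*} [Group G] (ρ : G →* (E →L[ℝ] E))
    (hρ : ∀ g v, ‖ρ g v‖ = ‖v‖) (g : G) (v w : E) : inner ℝ (ρ g v) (ρ g w) = inner ℝ v w :=
  LinearIsometry.inner_map_map ⟨(ρ g).toLinearMap, hρ g⟩ v w

theorem eq_of_inner_eq (hρ : ∀ g v, ‖ρ g v‖ = ‖v‖) {w : E} {g : SL(2, K)}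
    (h : inner ℝ w (ρ g w) = ‖w‖ ^ 2) : ρ g w = w := by
  have h1 := norm_sub_sq_real w (ρ g w)
  rw [h, hρ] at h1
  have h2 : ‖w - ρ g w‖ = 0 := by
    rw [← sq_eq_zero_iff, h1]; ring
  exact (sub_eq_zero.1 (norm_eq_zero.1 h2)).symm

theorem continuous_mk {X : Type*} [TopologicalSpace X] {f : X → SL(2, K)}
    (h : ∀ i j, Continuous fun x => f x i j) : Continuous f :=
  continuous_induced_rng.2 (continuous_matrix h)

/-- The Mautner phenomenon for `SL₂`: the matrix coefficient of a vector `w` fixed by the upper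
unipotent subgroup `N` is constant on `N`-double cosets, and these accumulate at the diagonal
matrices, so that its value there is `‖w‖²`. -/
theorem fixed_of_upper_fixed (hρ : ∀ g v, ‖ρ g v‖ = ‖v‖) (hc : ∀ v, Continuous fun g => ρ g v)
    {w : E} (hw : ∀ x, ρ (upperUnip x) w = w) (g : SL(2, K)) : ρ g w = w := by
  set f : SL(2, K) → ℝ := fun g => inner ℝ w (ρ g w)
  have hf : Continuous f := continuous_const.inner (hc w)
  have hf1 : f 1 = ‖w‖ ^ 2 := by simp [f]
  have hleft : ∀ x g, f (upperUnip x * g) = f g := fun x g => by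
    simp only [f, map_mul, mul_apply_eq_comp]
    conv_lhs => rw [← hw x]
    rw [inner_map_map_of_norm ρ hρ, hw]
  have hright : ∀ x g, f (g * upperUnip x) = f g := fun x g => by
    simp only [f, map_mul, mul_apply_eq_comp, hw]
  -- for a nonzero lower left entry, the double coset depends on that entry only
  have hcoset : ∀ g h : SL(2, K), g 1 0 = h 1 0 → g 1 0 ≠ 0 → f g = f h := fun g h hgh h0 => by
    have h1 : g =
        upperUnip ((g 0 0 - h 0 0) / g 1 0) * h * upperUnip ((g 1 1 - h 1 1) / g 1 0) := by
      have hg := det_eq g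
      have hh := det_eq h
      apply ext2 <;> simp only [mul_entry] <;> simp [upperUnip] <;> grind
    rw [h1, hright, hleft]
  -- diagonal matrices fix `w`
  have hlim : ∀ a : K, a ≠ 0 → ∀ h : K → SL(2, K), Continuous h → (∀ c, h c 1 0 = c) →
      Tendsto (fun c => f (lowerUnip c)) (𝓝[≠] 0) (𝓝 (f (h 0))) := fun a ha h hcont hh => by
    refine Tendsto.congr' ?_ ((hf.comp hcont).tendsto 0 |>.mono_left nhdsWithin_le_nhds)
    filter_upwards [self_mem_nhdsWithin] with c hc
    exact hcoset _ _ (by simp [hh, lowerUnip]) (by rw [hh]; exact hc)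
  have hlow : Continuous (lowerUnip : K → SL(2, K)) := continuous_mk fun i j => by
    fin_cases i <;> fin_cases j <;> simp [lowerUnip] <;> fun_prop
  have hlow0 : Tendsto (fun c : K => f (lowerUnip c)) (𝓝[≠] 0) (𝓝 (‖w‖ ^ 2)) := by
    have h := hlim 1 one_ne_zero lowerUnip hlow fun c => by simp [lowerUnip]
    have h0 : lowerUnip (0 : K) = 1 := by
      ext i j; fin_cases i <;> fin_cases j <;> simp [lowerUnip]
    rwa [h0, hf1] at h
  have hdiag : ∀ (a : K) (ha : a ≠ 0),
      ρ (mk2 a 0 0 a⁻¹ (by simp [ha])) w = w := fun a ha => by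
    refine eq_of_inner_eq ρ hρ ?_
    have h := hlim a ha (fun c => mk2 a 0 c a⁻¹ (by simp [ha])) (continuous_mk fun i j => by
      fin_cases i <;> fin_cases j <;> simp <;> fun_prop) fun c => by simp
    exact tendsto_nhds_unique h hlow0
  -- conjugating by diagonal matrices contracts the lower unipotents to the identity
  have hlower : ∀ c : K, c ≠ 0 → f (lowerUnip c) = ‖w‖ ^ 2 := fun c hc => by
    have hconj : ∀ a : K, a ≠ 0 → f (lowerUnip (c * a ^ 2)) = f (lowerUnip c) := fun a ha => by
      have h1 : mk2 a 0 0 a⁻¹ (by simp [ha]) * lowerUnip (c * a ^ 2) =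
          lowerUnip c * mk2 a 0 0 a⁻¹ (by simp [ha]) := by
        apply ext2 <;> simp only [mul_entry] <;> simp [lowerUnip]; field_simp
      have h2 : ρ (mk2 a 0 0 a⁻¹ (by simp [ha]) * lowerUnip (c * a ^ 2)) w =
          ρ (lowerUnip c) w := by
        rw [h1, map_mul, mul_apply_eq_comp, hdiag a ha]
      simp only [f]
      rw [← h2, map_mul, mul_apply_eq_comp]
      conv_rhs => rw [← hdiag a ha]
      rw [inner_map_map_of_norm ρ hρ, hdiag a ha]
    have h3 : Tendsto (fun a : K => c * a ^ 2) (𝓝[≠] 0) (𝓝[≠] 0) := by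
      refine tendsto_nhdsWithin_iff.2 ⟨?_, ?_⟩
      · exact ((continuous_const.mul (continuous_id.pow 2)).tendsto' (0 : K) 0 (by simp)).mono_left
          nhdsWithin_le_nhds
      · filter_upwards [self_mem_nhdsWithin] with a ha
        exact mul_ne_zero hc (pow_ne_zero 2 ha)
    refine tendsto_nhds_unique (Tendsto.congr' ?_ tendsto_const_nhds) (hlow0.comp h3)
    filter_upwards [self_mem_nhdsWithin] with a ha
    exact (hconj a ha).symm
  have hne : ∀ g : SL(2, K), g 1 0 ≠ 0 → ρ g w = w := fun g hg => by
    refine eq_of_inner_eq ρ hρ ?_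
    rw [← hlower _ hg]
    exact hcoset _ _ (by simp [lowerUnip]) hg
  by_cases hg : g 1 0 = 0
  · have h00 : g 0 0 ≠ 0 := fun h => by
      have := det_eq g
      simp [hg, h] at this
    have h1 : ρ (lowerUnip 1 * g) w = w := hne _ (by
      rw [mul_entry]
      simpa [lowerUnip, hg] using h00)
    have h2 : ρ (lowerUnip 1) w = w := hne _ (by simp [lowerUnip])
    rw [map_mul, mul_apply_eq_comp] at h1
    have h3 : ‖ρ g w - w‖ = 0 := by
      rw [← hρ (lowerUnip 1), map_sub, h1, h2, sub_self, norm_zero]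
    exact sub_eq_zero.1 (norm_eq_zero.1 h3)
  · exact hne g hg

end Mautner

/-! ### Weak limits of matrix coefficients -/

section WeakLimit

variable {E : Type*} [NormedAddCommGroup E] [InnerProductSpace ℝ E] [CompleteSpace E]

/-- A bounded family in a Hilbert space converges weakly along any ultrafilter. -/
theorem exists_weak_limit {ι : Type*} (U : Ultrafilter ι) (u : ι → E) {C : ℝ}
    (hC : ∀ i, ‖u i‖ ≤ C) :
    ∃ w : E, ∀ β, Tendsto (fun i => inner ℝ (u i) β) U (𝓝 (inner ℝ w β)) := by
  let T : ι → WeakDual ℝ E := fun i => StrongDual.toWeakDual (InnerProductSpace.toDual ℝ E (u i))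
  have hK := WeakDual.isCompact_closedBall (𝕜 := ℝ) (0 : StrongDual ℝ E) C
  obtain ⟨L, -, hL⟩ := hK.ultrafilter_le_nhds (U.map T) (by
    rw [le_principal_iff]
    change ∀ᶠ i in (U : Filter ι), T i ∈ _
    refine Eventually.of_forall fun i => ?_
    simp [T, hC i])
  refine ⟨(InnerProductSpace.toDual ℝ E).symm (WeakDual.toStrongDual L), fun β => ?_⟩
  have h1 : Tendsto (fun i => T i β) U (𝓝 (L β)) :=
    ((WeakDual.eval_continuous β).tendsto L).comp hL
  rw [InnerProductSpace.toDual_symm_apply]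
  exact h1

variable {K : Type*} [NontriviallyNormedField K] [ProperSpace K]

theorem exists_max_entry (A : SL(2, K)) :
    ∃ p : Fin 2 × Fin 2, A p.1 p.2 ≠ 0 ∧ ∀ k l, ‖A k l‖ ≤ ‖A p.1 p.2‖ := by
  obtain ⟨p, hp⟩ := Finite.exists_max fun p : Fin 2 × Fin 2 => ‖A p.1 p.2‖
  refine ⟨p, fun h0 => ?_, fun k l => hp (k, l)⟩
  have hz : ∀ k l, A k l = 0 := fun k l => by
    have := hp (k, l)
    rw [h0, norm_zero] at this
    exact norm_le_zero_iff.1 this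
  have := det_eq A
  simp [hz] at this

theorem isCompact_norm_le (R : ℝ) : IsCompact {A : SL(2, K) | ∀ i j, ‖A i j‖ ≤ R} := by
  have h : IsCompact (Set.pi Set.univ fun _ => Set.pi Set.univ fun _ => Metric.closedBall 0 R :
      Set (Fin 2 → Fin 2 → K)) :=
    isCompact_univ_pi fun _ => isCompact_univ_pi fun _ => isCompact_closedBall _ _
  have h2 := Matrix.SpecialLinearGroup.isClosedEmbedding_val.isCompact_preimage h
  have h3 : {A : SL(2, K) | ∀ i j, ‖A i j‖ ≤ R} =
      ((↑) : SL(2, K) → Matrix (Fin 2) (Fin 2) K) ⁻¹'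
        Set.pi Set.univ fun _ => Set.pi Set.univ fun _ => Metric.closedBall 0 R :=
    Set.ext fun A => ⟨fun hA i _ j _ => mem_closedBall_zero_iff.2 (hA i j),
      fun hA i j => mem_closedBall_zero_iff.1 (hA i trivial j trivial)⟩
  rwa [h3]

variable {G : Type*} [Group G] [TopologicalSpace G]

/-- The Howe–Moore argument. If the `SL₂(K)`-component of `g` leaves every compact set along `U`,
then the weak limit of `ρ(g) α` is fixed by `SL₂(K)`. With `λ = g_{ji}` the largest entry of `g`,
conjugation by `g⁻¹` takes the unipotent `1 + c v vᵀ J` for `v = g e_i / λ` to the one for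
`e_i / λ`, which tends to the identity, so the weak limit is fixed by `1 + c v vᵀ J` for
`v = lim g e_i / λ`. -/
theorem exists_fixed_weak_limit (ι : SL(2, K) →* G) (hι : Continuous ι) (pr : G → SL(2, K))
    (hconj : ∀ g x, g⁻¹ * ι x * g = ι ((pr g)⁻¹ * x * pr g))
    (ρ : G →* (E →L[ℝ] E)) (hρ : ∀ g v, ‖ρ g v‖ = ‖v‖) (hc : ∀ v, Continuous fun g => ρ g v)
    (U : Ultrafilter G) (hU : Tendsto pr U (cocompact (SL(2, K)))) (α : E) :
    ∃ w : E, (∀ β, Tendsto (fun g => inner ℝ (ρ g α) β) U (𝓝 (inner ℝ w β))) ∧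
      ∀ x, ρ (ι x) w = w := by
  obtain ⟨w, hw⟩ := exists_weak_limit U (fun g => ρ g α) fun g => (hρ g α).le
  refine ⟨w, hw, ?_⟩
  choose p hp0 hp using exists_max_entry (K := K)
  let lam : G → K := fun g => pr g (p (pr g)).1 (p (pr g)).2
  let e : G → Fin 2 → K := fun g => (lam g)⁻¹ • Pi.single (p (pr g)).2 1
  let v : G → Fin 2 → K := fun g => (pr g).1.mulVec (e g)
  have hv : ∀ g k, v g k = (lam g)⁻¹ * pr g k (p (pr g)).2 := fun g k => by
    simp [v, e, Matrix.mulVec_smul]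
  -- the directions `v g` subconverge to a nonzero vector
  have hcpt : IsCompact (Metric.closedBall (0 : Fin 2 → K) 1 ∩ ⋃ k, {v | v k = 1}) :=
    (isCompact_closedBall _ _).inter_right
      (isClosed_iUnion_of_finite fun k => isClosed_eq (continuous_apply k) continuous_const)
  obtain ⟨v₀, hv₀, hlim⟩ := hcpt.ultrafilter_le_nhds (U.map v) (by
    rw [le_principal_iff]
    change ∀ᶠ g in (U : Filter G), v g ∈ _
    refine Eventually.of_forall fun g => ⟨?_, Set.mem_iUnion.2 ⟨(p (pr g)).1, ?_⟩⟩
    · rw [mem_closedBall_zero_iff, pi_norm_le_iff_of_nonneg zero_le_one]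
      intro k
      rw [hv, norm_mul, norm_inv, inv_mul_le_one₀ (norm_pos_iff.2 (hp0 _))]
      exact hp _ _ _
    · change v g _ = 1
      rw [hv]
      exact inv_mul_cancel₀ (hp0 _))
  have hv₀ne : v₀ ≠ 0 := by
    rintro rfl
    obtain ⟨k, hk⟩ := Set.mem_iUnion.1 hv₀.2
    exact zero_ne_one hk
  have hlam : Tendsto (fun g => ‖lam g‖) U atTop := by
    refine tendsto_atTop.2 fun R => ?_
    filter_upwards [hU (isCompact_norm_le R).compl_mem_cocompact] with g hg
    by_contra hlt
    exact hg fun i j => (hp _ i j).trans (not_le.1 hlt).le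
  have he : Tendsto e U (𝓝 0) := by
    rw [tendsto_zero_iff_norm_tendsto_zero]
    refine (tendsto_inv_atTop_zero.comp hlam).congr fun g => ?_
    simp [e, norm_smul, Pi.norm_single]
  have hcu : ∀ c : K, Continuous (unip c) := fun c => continuous_mk fun i j => by
    fin_cases i <;> fin_cases j <;> simp [unip] <;> fun_prop
  have hfix : ∀ c, ρ (ι (unip c v₀)) w = w := fun c => by
    refine ext_inner_right ℝ fun β => ?_
    set x : G → SL(2, K) := fun g => unip c (v g)
    have hx : Tendsto x U (𝓝 (unip c v₀)) := ((hcu c).tendsto v₀).comp hlim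
    -- moving the unipotent to the other side, where it acts on a fixed vector
    have hadj : ∀ (g : G) (a b : E), inner ℝ (ρ g a) b = inner ℝ a (ρ g⁻¹ b) := fun g a b => by
      rw [← inner_map_map_of_norm ρ hρ g a, ← mul_apply_eq_comp, ← map_mul]
      simp
    have h1 : Tendsto (fun g => inner ℝ (ρ (ι (x g)) (ρ g α)) β) U
        (𝓝 (inner ℝ (ρ (ι (unip c v₀)) w) β)) := by
      rw [hadj]
      have h2 := hw (ρ (ι (unip c v₀))⁻¹ β)
      have h3 : Tendsto (fun g => ρ (ι (x g))⁻¹ β - ρ (ι (unip c v₀))⁻¹ β) U (𝓝 0) := by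
        rw [← sub_self (ρ (ι (unip c v₀))⁻¹ β)]
        refine Tendsto.sub ?_ tendsto_const_nhds
        have h4 : Continuous fun y : SL(2, K) => ρ (ι y)⁻¹ β := by
          have h5 : Continuous fun y : SL(2, K) => ρ (ι y⁻¹) β :=
            (hc β).comp (hι.comp continuous_inv)
          simpa only [map_inv] using h5
        exact (h4.tendsto _).comp hx
      have h6 : Tendsto (fun g => inner ℝ (ρ g α) (ρ (ι (x g))⁻¹ β - ρ (ι (unip c v₀))⁻¹ β)) U
          (𝓝 0) := by
        refine squeeze_zero_norm (fun g => (norm_inner_le_norm _ _).trans_eq (by rw [hρ])) ?_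
        simpa using h3.norm.const_mul ‖α‖
      have h7 := h2.add h6
      rw [add_zero] at h7
      refine h7.congr fun g => ?_
      rw [hadj (ι (x g)), ← inner_add_right]
      congr 1
      abel
    -- the conjugates of the unipotents tend to the identity
    have h2 : Tendsto (fun g => inner ℝ (ρ (ι (x g)) (ρ g α)) β) U (𝓝 (inner ℝ w β)) := by
      have h3 : ∀ g, ρ (ι (x g)) (ρ g α) = ρ g (ρ (ι (unip c (e g))) α) := fun g => by
        rw [← mul_apply_eq_comp, ← mul_apply_eq_comp, ← map_mul, ← map_mul]
        congr 2
        have h4 := hconj g (x g)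
        have h5 : (pr g)⁻¹ * x g * pr g = unip c (e g) := by
          rw [mul_assoc, ← unip_mulVec, inv_mul_cancel_left]
        rw [h5] at h4
        rw [← h4]; group
      have h4 : Tendsto (fun g => ρ (ι (unip c (e g))) α - α) U (𝓝 0) := by
        have h5 : Continuous fun y : Fin 2 → K => ρ (ι (unip c y)) α - α :=
          ((hc α).comp (hι.comp (hcu c))).sub continuous_const
        have h6 := (h5.tendsto 0).comp he
        simpa [unip_zero, Function.comp_def] using h6
      have h6 : Tendsto (fun g => inner ℝ (ρ g (ρ (ι (unip c (e g))) α - α)) β) U (𝓝 0) := by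
        refine squeeze_zero_norm (fun g => (norm_inner_le_norm _ _).trans_eq (by rw [hρ])) ?_
        simpa using h4.norm.mul_const ‖β‖
      have h7 := (hw β).add h6
      rw [add_zero] at h7
      refine h7.congr fun g => ?_
      rw [h3, ← inner_add_left, ← map_add]
      congr 2
      abel_nf
    exact tendsto_nhds_unique h1 h2
  -- `unip c v₀` is conjugate to `upperUnip c`
  obtain ⟨B, hB⟩ := exists_mulVec_eq hv₀ne
  have hup : ∀ c, ρ (ι (upperUnip c)) (ρ (ι B)⁻¹ w) = ρ (ι B)⁻¹ w := fun c => by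
    have h1 : upperUnip c * B⁻¹ = B⁻¹ * unip c v₀ := by
      rw [← unip_single, eq_inv_mul_iff_mul_eq, ← mul_assoc, unip_mulVec, hB, mul_inv_cancel_right]
    rw [← map_inv ι, ← mul_apply_eq_comp, ← map_mul, ← map_mul, h1, map_mul, map_mul,
      mul_apply_eq_comp, hfix]
  have hall := fixed_of_upper_fixed (ρ.comp ι) (fun g v => hρ _ v) (fun v => (hc v).comp hι) hup
  have hw' : ρ (ι B)⁻¹ w = w := by
    have h1 := hall B
    simp only [MonoidHom.comp_apply] at h1
    rw [← h1, ← mul_apply_eq_comp, ← map_mul, mul_inv_cancel, map_one,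
      one_apply_eq_self]
  intro x
  have := hall x
  rwa [hw'] at this

end WeakLimit

end HoweMoore

namespace SArith

open HoweMoore

/-! ### Discreteness of `SL₂(ℤ_S)` -/

section Instances

variable (K : Type*) [NontriviallyNormedField K] [ProperSpace K]

instance polishSpace_SL2 : PolishSpace SL(2, K) := by
  have : PolishSpace (Matrix (Fin 2) (Fin 2) K) :=
    inferInstanceAs (PolishSpace (Fin 2 → Fin 2 → K))
  exact Matrix.SpecialLinearGroup.isClosedEmbedding_val.polishSpace

instance locallyCompactSpace_SL2 : LocallyCompactSpace SL(2, K) := by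
  have : LocallyCompactSpace (Matrix (Fin 2) (Fin 2) K) :=
    inferInstanceAs (LocallyCompactSpace (Fin 2 → Fin 2 → K))
  exact Matrix.SpecialLinearGroup.isClosedEmbedding_val.locallyCompactSpace

end Instances

section Discrete

variable {S : Finset Nat.Primes}

theorem continuous_entry_real (i j : Fin 2) : Continuous fun g : G S => g.1.1 i j :=
  (continuous_subtype_val.comp continuous_fst).matrix_elem i j

theorem continuous_entry_padic (p : S) (i j : Fin 2) : Continuous fun g : G S => (g.2 p).1 i j :=
  (continuous_subtype_val.comp ((continuous_apply p).comp continuous_snd)).matrix_elem i j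

theorem diag_real (γ : SL(2, SInt S)) (i j : Fin 2) : (diag S γ).1.1 i j = ((γ.1 i j : ℚ) : ℝ) :=
  rfl

theorem diag_padic (γ : SL(2, SInt S)) (p : S) (i j : Fin 2) :
    ((diag S γ).2 p).1 i j = ((γ.1 i j : ℚ) : ℚ_[p.1.1]) := rfl

theorem exists_int_of_padicNorm_le_one {x : ℚ} (h : ∀ p : Nat.Primes, padicNorm p.1 x ≤ 1) :
    ∃ n : ℤ, x = n := by
  refine ⟨x.num, (Rat.coe_int_num_of_den_eq_one ?_).symm⟩
  by_contra hd
  obtain ⟨p, hp, hpd⟩ := Nat.exists_prime_and_dvd hd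
  have : Fact p.Prime := ⟨hp⟩
  have h1 : padicNorm p x.num = 1 := by
    rw [padicNorm.int_eq_one_iff]
    intro h2
    have h3 : p ∣ x.num.natAbs := Int.natCast_dvd.1 h2
    exact hp.one_lt.ne' (Nat.eq_one_of_dvd_coprimes x.reduced h3 hpd)
  have h2 : padicNorm p x.den < 1 := (padicNorm.nat_lt_one_iff _).2 hpd
  have h3 := h ⟨p, hp⟩
  have h4 : padicNorm p x * padicNorm p x.den = 1 := by
    rw [← padicNorm.mul, Rat.mul_den_eq_num, h1]
  have h5 : 0 ≤ padicNorm p x.den := padicNorm.nonneg _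
  have h6 : 0 ≤ padicNorm p x := padicNorm.nonneg _
  change padicNorm p x ≤ 1 at h3
  nlinarith

theorem norm_ratCast_le_one_iff {p : ℕ} [Fact p.Prime] {x : ℚ} :
    ‖(x : ℚ_[p])‖ ≤ 1 ↔ padicNorm p x ≤ 1 := by
  rw [Padic.eq_padicNorm]; exact_mod_cast Iff.rfl

/-- A neighbourhood of `1` in `G` meeting `SL₂(ℤ_S)` only in `1`: an element of the intersection is
integral at every prime and has real distance less than `1` from the identity matrix. -/
theorem eq_one_of_near {γ : SL(2, SInt S)}
    (h1 : ∀ i j, |(diag S γ).1.1 i j - (1 : Matrix (Fin 2) (Fin 2) ℝ) i j| < 1)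
    (h2 : ∀ (p : S) i j, ‖((diag S γ).2 p).1 i j‖ ≤ 1) : γ = 1 := by
  ext i j
  obtain ⟨n, hn⟩ := exists_int_of_padicNorm_le_one (x := (γ.1 i j : ℚ)) fun p => by
    by_cases hp : p ∈ S
    · have := h2 ⟨p, hp⟩ i j
      rw [diag_padic] at this
      exact norm_ratCast_le_one_iff.1 this
    · exact (γ.1 i j).2 p hp
  have h3 := h1 i j
  rw [diag_real, hn] at h3
  have h4 : (1 : Matrix (Fin 2) (Fin 2) ℝ) i j =
      (((1 : Matrix (Fin 2) (Fin 2) ℤ) i j : ℤ) : ℝ) := by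
    fin_cases i <;> fin_cases j <;> simp
  rw [h4] at h3
  have h5 : n = (1 : Matrix (Fin 2) (Fin 2) ℤ) i j := by
    have : |n - (1 : Matrix (Fin 2) (Fin 2) ℤ) i j| < 1 := by exact_mod_cast h3
    rw [Int.abs_lt_one_iff] at this
    omega
  rw [hn, h5]
  fin_cases i <;> fin_cases j <;> simp

instance discreteTopology_Gam : DiscreteTopology (Gam S) := by
  refine discreteTopology_of_isOpen_singleton_one ?_
  let U : Set (G S) := (⋂ i, ⋂ j, {g | |g.1.1 i j - (1 : Matrix (Fin 2) (Fin 2) ℝ) i j| < 1}) ∩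
    ⋂ p : S, ⋂ i, ⋂ j, {g | (g.2 p).1 i j ∈ Metric.closedBall (0 : ℚ_[p.1.1]) 1}
  have hU : IsOpen U := by
    refine IsOpen.inter ?_ ?_
    · refine isOpen_iInter_of_finite fun i => isOpen_iInter_of_finite fun j => ?_
      exact isOpen_lt ((continuous_entry_real i j).sub continuous_const).abs continuous_const
    · refine isOpen_iInter_of_finite fun p => isOpen_iInter_of_finite fun i =>
        isOpen_iInter_of_finite fun j => ?_
      exact (IsUltrametricDist.isOpen_closedBall _ one_ne_zero).preimage
        (continuous_entry_padic p i j)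
  have : ({1} : Set (Gam S)) = Subtype.val ⁻¹' U := by
    ext ⟨g, γ, rfl⟩
    simp only [Set.mem_singleton_iff, Set.mem_preimage, U, Set.mem_inter_iff, Set.mem_iInter]
    constructor
    · intro h
      have h' : diag S γ = 1 := congrArg Subtype.val h
      rw [h']
      refine ⟨fun i j => ?_, fun p i j => ?_⟩
      · change |(1 : Matrix (Fin 2) (Fin 2) ℝ) i j - (1 : Matrix (Fin 2) (Fin 2) ℝ) i j| < 1
        simp
      · change (1 : Matrix (Fin 2) (Fin 2) ℚ_[p.1.1]) i j ∈ Metric.closedBall (0 : ℚ_[p.1.1]) 1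
        fin_cases i <;> fin_cases j <;> simp
    · rintro ⟨h1, h2⟩
      have h3 : γ = 1 := eq_one_of_near h1 fun p i j => by simpa using h2 p i j
      subst h3
      exact Subtype.ext (map_one _)
  rw [this]
  exact hU.preimage continuous_subtype_val

end Discrete

/-! ### Approximation by `S`-integers -/

section Density

variable {S : Finset Nat.Primes}

theorem inv_prime_mem {p : Nat.Primes} (hp : p ∈ S) : ((p.1 : ℚ))⁻¹ ∈ SInt S := by
  intro q hq
  have hne : q.1 ≠ p.1 := fun h => hq (by rwa [show q = p from Subtype.ext h])
  have h1 : ‖((p.1 : ℕ) : ℚ_[q.1])‖ = 1 :=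
    Padic.norm_natCast_eq_one_iff.2 ((Nat.coprime_primes q.2 p.2).2 hne)
  rw [← norm_ratCast_le_one_iff]
  push_cast
  rw [norm_inv, h1, inv_one]

/-- The product of the primes in `S` other than `p`. -/
def cofactor (S : Finset Nat.Primes) (p : Nat.Primes) : ℕ := ∏ q ∈ S.erase p, q.1

theorem norm_cofactor_le {p q : Nat.Primes} (hq : q ∈ S) (hqp : q ≠ p) :
    ‖(cofactor S p : ℚ_[q.1])‖ ≤ 1 / 2 := by
  obtain ⟨n, hn⟩ := Finset.dvd_prod_of_mem (fun q : Nat.Primes => q.1)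
    (Finset.mem_erase.2 ⟨hqp, hq⟩)
  rw [cofactor, hn, Nat.cast_mul, norm_mul, Padic.norm_p]
  have h1 : ‖(n : ℚ_[q.1])‖ ≤ 1 := by exact_mod_cast Padic.norm_int_le_one (p := q.1) n
  have h2 : ((q.1 : ℝ))⁻¹ ≤ 1 / 2 := by
    rw [inv_eq_one_div]
    exact one_div_le_one_div_of_le two_pos (by exact_mod_cast q.2.two_le)
  calc _ ≤ (1 / 2 : ℝ) * 1 := by gcongr
    _ = 1 / 2 := by norm_num

theorem cofactor_ne_zero (p : Nat.Primes) : cofactor S p ≠ 0 :=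
  Finset.prod_ne_zero_iff.2 fun q _ => q.2.ne_zero

theorem exists_pow_half_lt {ε : ℝ} (hε : 0 < ε) : ∃ m : ℕ, (1 / 2 : ℝ) ^ m < ε :=
  exists_pow_lt_of_lt_one hε (by norm_num)

/-- Multiples `N ^ m u` of a power of the product `N` of the primes in `S` other than `p`, with `u`
integral outside `p`, are small at these primes. -/
theorem norm_cofactor_pow_mul_lt {p q : Nat.Primes} (hq : q ∈ S) (hqp : q ≠ p) {ε : ℝ} {m k : ℕ}
    (hm : (1 / 2 : ℝ) ^ m < ε) (n : ℤ) :
    ‖(((cofactor S p : ℚ) ^ m * (n * ((p.1 : ℚ)⁻¹) ^ k) : ℚ) : ℚ_[q.1])‖ < ε := by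
  push_cast
  rw [norm_mul, norm_mul, norm_pow, norm_pow, norm_inv]
  have h1 : ‖(n : ℚ_[q.1])‖ ≤ 1 := Padic.norm_int_le_one n
  have h2 : ‖((p.1 : ℕ) : ℚ_[q.1])‖ = 1 := by
    rw [Padic.norm_natCast_eq_one_iff]
    exact (Nat.coprime_primes q.2 p.2).2 fun h => hqp (Subtype.ext h)
  rw [h2]
  refine lt_of_le_of_lt ?_ hm
  calc _ ≤ (1 / 2 : ℝ) ^ m * (1 * 1⁻¹ ^ k) := by
        gcongr; exact norm_cofactor_le hq hqp
    _ = _ := by simp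

theorem cofactor_pow_mul_mem {p : Nat.Primes} (hp : p ∈ S) (m k : ℕ) (n : ℤ) :
    ((cofactor S p : ℚ) ^ m * (n * ((p.1 : ℚ)⁻¹) ^ k)) ∈ SInt S :=
  mul_mem (pow_mem (natCast_mem _ _) _) (mul_mem (intCast_mem _ _) (pow_mem (inv_prime_mem hp) _))

/-- An element of `ℤ_S` close to a given `p`-adic number and small at the other primes in `S`. -/
theorem exists_approx_single {p : Nat.Primes} (hp : p ∈ S) (x : ℚ_[p.1]) {ε : ℝ} (hε : 0 < ε) :
    ∃ z ∈ SInt S, ‖(z : ℚ_[p.1]) - x‖ < ε ∧ ∀ q ∈ S, q ≠ p → ‖(z : ℚ_[q.1])‖ < ε := by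
  obtain ⟨m, hm⟩ := exists_pow_half_lt hε
  have hN0 : (cofactor S p : ℚ_[p.1]) ≠ 0 := by exact_mod_cast cofactor_ne_zero p
  have hp0 : ((p.1 : ℕ) : ℚ_[p.1]) ≠ 0 := by exact_mod_cast p.2.ne_zero
  set y : ℚ_[p.1] := x / (cofactor S p) ^ m
  -- scale `y` into `ℤ_p` and approximate there by an integer
  obtain ⟨k, hk⟩ : ∃ k : ℕ, ‖((p.1 : ℕ) : ℚ_[p.1]) ^ k * y‖ ≤ 1 := by
    have h1 : Tendsto (fun k : ℕ => ‖((p.1 : ℕ) : ℚ_[p.1]) ^ k * y‖) atTop (𝓝 0) := by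
      have h2 := (tendsto_pow_atTop_nhds_zero_of_norm_lt_one
        (Padic.norm_p_lt_one (p := p.1))).mul_const y
      rw [zero_mul] at h2
      simpa using h2.norm
    exact (h1.eventually (ge_mem_nhds one_pos)).exists
  have hc : 0 < ‖((cofactor S p : ℚ_[p.1])) ^ m / ((p.1 : ℕ) : ℚ_[p.1]) ^ k‖ :=
    norm_pos_iff.2 (div_ne_zero (pow_ne_zero _ hN0) (pow_ne_zero _ hp0))
  let u : ℤ_[p.1] := ⟨_, hk⟩
  obtain ⟨n, hn⟩ := PadicInt.denseRange_intCast.exists_dist_lt u (div_pos hε hc)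
  refine ⟨_, cofactor_pow_mul_mem hp m k n, ?_,
    fun q hq hqp => norm_cofactor_pow_mul_lt hq hqp hm n⟩
  have h0 : dist u n = ‖((u - n : ℤ_[p.1]) : ℚ_[p.1])‖ := rfl
  rw [h0, PadicInt.coe_sub, PadicInt.coe_intCast, norm_sub_rev] at hn
  change ‖(n : ℚ_[p.1]) - ((p.1 : ℕ) : ℚ_[p.1]) ^ k * y‖ < _ at hn
  push_cast
  have h1 : (cofactor S p : ℚ_[p.1]) ^ m * (n * (((p.1 : ℕ) : ℚ_[p.1])⁻¹) ^ k) - x =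
      ((cofactor S p : ℚ_[p.1])) ^ m / ((p.1 : ℕ) : ℚ_[p.1]) ^ k *
        (n - ((p.1 : ℕ) : ℚ_[p.1]) ^ k * y) := by
    simp only [y]
    rw [inv_pow]
    field_simp
  rw [h1, norm_mul]
  rw [lt_div_iff₀ hc] at hn
  linarith

/-- `ℤ_S` is dense in `∏_{p ∈ S} ℚ_p`. -/
theorem exists_approx_padic (x : (p : S) → ℚ_[p.1.1]) {ε : ℝ} (hε : 0 < ε) :
    ∃ z ∈ SInt S, ∀ p : S, ‖(z : ℚ_[p.1.1]) - x p‖ < ε := by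
  choose z hz hz1 hz2 using fun p : S => exists_approx_single p.2 (x p) hε
  refine ⟨∑ p, z p, sum_mem fun p _ => hz p, fun p => ?_⟩
  have h1 : ((∑ q, z q : ℚ) : ℚ_[p.1.1]) - x p =
      ((z p : ℚ_[p.1.1]) - x p) + ∑ q ∈ Finset.univ.erase p, (z q : ℚ_[p.1.1]) := by
    rw [Rat.cast_sum, ← Finset.add_sum_erase _ _ (Finset.mem_univ p)]; ring
  rw [h1]
  refine lt_of_le_of_lt (IsUltrametricDist.norm_add_le_max _ _) (max_lt (hz1 p) ?_)
  obtain h | h := (Finset.univ.erase p).eq_empty_or_nonempty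
  · rw [h]; simpa using hε
  · obtain ⟨q, hq, hle⟩ := IsUltrametricDist.exists_norm_finsetSum_le_of_nonempty h
      fun q => (z q : ℚ_[p.1.1])
    refine lt_of_le_of_lt hle (hz2 q p.1 p.2 fun h => ?_)
    exact (Finset.mem_erase.1 hq).1 (Subtype.ext h.symm)

/-- `ℤ_S` is dense in the product of `ℝ` and the `ℚ_q` for `q ∈ S` different from `p`. -/
theorem exists_approx_real (p : S) (r : ℝ) (x : (p : S) → ℚ_[p.1.1]) {ε : ℝ} (hε : 0 < ε) :
    ∃ z ∈ SInt S, |(z : ℝ) - r| < ε ∧ ∀ q : S, q ≠ p → ‖(z : ℚ_[q.1.1]) - x q‖ < ε := by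
  obtain ⟨z, hz, hzx⟩ := exists_approx_padic x hε
  obtain ⟨m, hm⟩ := exists_pow_half_lt hε
  have hN : (0 : ℝ) < (cofactor S p.1 : ℝ) ^ m :=
    pow_pos (Nat.cast_pos.2 (Nat.pos_of_ne_zero (cofactor_ne_zero p.1))) _
  obtain ⟨k, hk⟩ := exists_pow_half_lt (div_pos hε hN)
  set c : ℝ := (cofactor S p.1 : ℝ) ^ m * ((p.1.1 : ℝ)⁻¹) ^ k
  have hp0 : (0 : ℝ) < p.1.1 := Nat.cast_pos.2 p.1.2.pos
  have hc : 0 < c := mul_pos hN (pow_pos (inv_pos.2 hp0) _)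
  have hcε : c < ε := by
    have h1 : ((p.1.1 : ℝ)⁻¹) ^ k ≤ (1 / 2 : ℝ) ^ k := by
      gcongr
      rw [inv_eq_one_div]
      exact one_div_le_one_div_of_le two_pos (by exact_mod_cast p.1.2.two_le)
    calc c ≤ (cofactor S p.1 : ℝ) ^ m * (1 / 2 : ℝ) ^ k := by simp only [c]; gcongr
      _ < ε := by rwa [lt_div_iff₀ hN, mul_comm] at hk
  set n : ℤ := ⌊(r - z) / c⌋
  refine ⟨_, add_mem hz (cofactor_pow_mul_mem p.2 m k n), ?_, fun q hq => ?_⟩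
  · have h1 : (n : ℝ) * c ≤ r - z := (le_div_iff₀ hc).1 (Int.floor_le _)
    have h2 : r - z < (n + 1) * c := (div_lt_iff₀ hc).1 (Int.lt_floor_add_one _)
    have h3 : (((z + (cofactor S p.1 : ℚ) ^ m * (n * ((p.1.1 : ℚ)⁻¹) ^ k) : ℚ) : ℝ)) - r =
        n * c - (r - z) := by
      push_cast; simp only [c]; ring
    rw [h3, abs_lt]
    constructor <;> linarith
  · rw [Rat.cast_add, add_sub_right_comm]
    refine lt_of_le_of_lt (IsUltrametricDist.norm_add_le_max _ _) (max_lt (hzx q) ?_)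
    exact norm_cofactor_pow_mul_lt q.2 (fun h => hq (Subtype.ext h)) hm n

end Density

end SArith

namespace SArith

open HoweMoore LatticeQuotient

/-! ### Strong approximation for `SL₂` -/

section StrongApproximation

variable {S : Finset Nat.Primes}

/-- The elementary unipotent matrices: upper triangular if `b` is true, lower triangular if not. -/
def elem {R : Type*} [CommRing R] (b : Bool) (x : R) : SL(2, R) :=
  if b then upperUnip x else lowerUnip x

theorem elem_zero {R : Type*} [CommRing R] (b : Bool) : elem b (0 : R) = 1 := by
  cases b <;> apply ext2 <;> simp [elem, upperUnip, lowerUnip]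

theorem elem_add {R : Type*} [CommRing R] (b : Bool) (x y : R) :
    elem b (x + y) = elem b x * elem b y := by
  cases b <;> simp only [elem] <;> apply ext2 <;> simp only [mul_entry] <;>
    simp [upperUnip, lowerUnip, add_comm]

theorem continuous_elem {K : Type*} [NontriviallyNormedField K] (b : Bool) :
    Continuous (elem b : K → SL(2, K)) := continuous_mk fun i j => by
  cases b <;> fin_cases i <;> fin_cases j <;> simp [elem, upperUnip, lowerUnip] <;> fun_prop

theorem map_elem {R R' : Type*} [CommRing R] [CommRing R'] (f : R →+* R') (b : Bool) (x : R) :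
    Matrix.SpecialLinearGroup.map f (elem b x) = elem b (f x) := by
  cases b <;> ext i j <;> fin_cases i <;> fin_cases j <;> simp [elem, upperUnip, lowerUnip]

/-- Every matrix in `SL₂` over a field is a product of four elementary ones. -/
theorem exists_eq_elem_mul {K : Type*} [Field K] (g : SL(2, K)) :
    ∃ t x y w : K, g = elem false t * elem true x * elem false y * elem true w := by
  have key : ∀ h : SL(2, K), h.1 1 0 ≠ 0 →
      ∃ x y w : K, h = elem true x * elem false y * elem true w := fun h h0 => by
    have hd := det_eq h
    refine ⟨(h.1 0 0 - 1) / h.1 1 0, h.1 1 0, (h.1 1 1 - 1) / h.1 1 0, ?_⟩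
    apply ext2 <;> simp only [mul_entry] <;> simp [elem, upperUnip, lowerUnip] <;> grind
  obtain ⟨t, ht⟩ : ∃ t : K, (elem false (-t) * g).1 1 0 ≠ 0 := by
    by_cases h0 : g.1 1 0 = 0
    · refine ⟨1, ?_⟩
      have hd := det_eq g
      rw [mul_entry]
      intro h
      simp [h0, elem, lowerUnip] at h hd
      simp [h] at hd
    · exact ⟨0, by rw [mul_entry]; simpa [elem, lowerUnip] using h0⟩
  have h1 : g = elem false t * (elem false (-t) * g) := by
    rw [← mul_assoc, ← elem_add, add_neg_cancel, elem_zero, one_mul]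
  obtain ⟨x, y, w, h2⟩ := key _ ht
  exact ⟨t, x, y, w, by rw [h1, h2]; simp only [mul_assoc]⟩

/-- The product `ℝ × ∏_{p ∈ S} ℚ_p`. -/
abbrev Adeles (S : Finset Nat.Primes) : Type := ℝ × ((p : S) → ℚ_[p.1.1])

/-- The diagonal embedding of `ℚ` into `ℝ × ∏_{p ∈ S} ℚ_p`. -/
def ratAdele (z : ℚ) : Adeles S := (z, fun p => (z : ℚ_[p.1.1]))

theorem ratAdele_fst (z : ℚ) : (ratAdele z : Adeles S).1 = (z : ℝ) := rfl

theorem ratAdele_snd (z : ℚ) (p : S) : (ratAdele z : Adeles S).2 p = (z : ℚ_[p.1.1]) := rfl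

/-- The elementary unipotent elements of `G`. -/
def elemG (b : Bool) (x : Adeles S) : G S := (elem b x.1, fun p => elem b (x.2 p))

theorem continuous_elemG (b : Bool) : Continuous (elemG (S := S) b) :=
  ((continuous_elem b).comp continuous_fst).prodMk (continuous_pi fun p =>
    (continuous_elem b).comp ((continuous_apply p).comp continuous_snd))

theorem elemG_add (b : Bool) (x y : Adeles S) : elemG b (x + y) = elemG b x * elemG b y :=
  Prod.ext (elem_add b _ _) (funext fun _ => elem_add b _ _)

theorem elemG_mem_Gam (b : Bool) {z : ℚ} (hz : z ∈ SInt S) :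
    elemG b (ratAdele z) ∈ Gam S :=
  ⟨elem b ⟨z, hz⟩, Prod.ext (map_elem _ b _) (funext fun _ => map_elem _ b _)⟩

/-- A subgroup of `G` is dense once it contains densely many elementary unipotents of each type, as
these generate `G`. -/
theorem closure_eq_top {L : Subgroup (G S)}
    (h : ∀ b, Dense {x : Adeles S | elemG b x ∈ L}) : L.topologicalClosure = ⊤ := by
  have hmem : ∀ b x, elemG b x ∈ L.topologicalClosure := fun b x =>
    map_mem_closure (continuous_elemG b) (h b x) fun y hy => hy
  rw [eq_top_iff]
  rintro g -
  obtain ⟨t, x, y, w, h1⟩ := exists_eq_elem_mul g.1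
  choose t' x' y' w' h2 using fun p => exists_eq_elem_mul (g.2 p)
  have : g = elemG false (t, t') * elemG true (x, x') * elemG false (y, y') * elemG true (w, w') :=
    Prod.ext h1 (funext h2)
  rw [this]
  exact mul_mem (mul_mem (mul_mem (hmem _ _) (hmem _ _)) (hmem _ _)) (hmem _ _)

theorem exists_dist_lt_imp_dense {s : Set (Adeles S)}
    (h : ∀ (r : ℝ) (x : (p : S) → ℚ_[p.1.1]) (ε : ℝ), 0 < ε →
      ∃ y ∈ s, |y.1 - r| < ε ∧ ∀ p, ‖y.2 p - x p‖ < ε) : Dense s := by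
  rw [Metric.dense_iff]
  rintro ⟨r, x⟩ ε hε
  obtain ⟨y, hy, h1, h2⟩ := h r x ε hε
  refine ⟨y, ?_, hy⟩
  rw [Metric.mem_ball, Prod.dist_eq, max_lt_iff]
  exact ⟨by rwa [Real.dist_eq], (dist_pi_lt_iff hε).2 fun p => by rw [dist_eq_norm]; exact h2 p⟩

/-- The inclusion of the factor `SL₂(ℝ)` into `G`. -/
def inclReal (S : Finset Nat.Primes) : SL(2, ℝ) →* G S := MonoidHom.inl _ _

/-- The inclusion of the factor `SL₂(ℚ_p)` into `G`. -/
def inclPadic (p : S) : SL(2, ℚ_[p.1.1]) →* G S :=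
  (MonoidHom.inr _ _).comp (MonoidHom.mulSingle (fun p : S => SL(2, ℚ_[p.1.1])) p)

theorem inclReal_apply (x : SL(2, ℝ)) : inclReal S x = (x, 1) := rfl

theorem inclPadic_apply (p : S) (x : SL(2, ℚ_[p.1.1])) :
    inclPadic p x = (1, Pi.mulSingle p x) := rfl

theorem continuous_inclReal : Continuous (inclReal S) := Continuous.prodMk_left 1

theorem continuous_inclPadic (p : S) : Continuous (inclPadic p) :=
  continuous_const.prodMk (continuous_mulSingle (A := fun p : S => SL(2, ℚ_[p.1.1])) p)

theorem inclReal_conj (g : G S) (x : SL(2, ℝ)) :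
    g⁻¹ * inclReal S x * g = inclReal S (g.1⁻¹ * x * g.1) := by
  obtain ⟨a, b⟩ := g
  rw [inclReal_apply, inclReal_apply, Prod.inv_mk, Prod.mk_mul_mk, Prod.mk_mul_mk, mul_one,
    inv_mul_cancel]

theorem inclPadic_conj (p : S) (g : G S) (x : SL(2, ℚ_[p.1.1])) :
    g⁻¹ * inclPadic p x * g = inclPadic p ((g.2 p)⁻¹ * x * g.2 p) := by
  obtain ⟨a, b⟩ := g
  have h : b⁻¹ * Pi.mulSingle p x * b = Pi.mulSingle p ((b p)⁻¹ * x * b p) := by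
    funext q
    rw [Pi.mul_apply, Pi.mul_apply, Pi.inv_apply]
    by_cases h : q = p
    · subst h; rw [Pi.mulSingle_eq_same, Pi.mulSingle_eq_same]
    · rw [Pi.mulSingle_eq_of_ne h, Pi.mulSingle_eq_of_ne h, mul_one, inv_mul_cancel]
  rw [inclPadic_apply, inclPadic_apply, Prod.inv_mk, Prod.mk_mul_mk, Prod.mk_mul_mk, mul_one,
    inv_mul_cancel, h]

theorem elemG_real (b : Bool) (r : ℝ) :
    elemG b ((r, 0) : Adeles S) = inclReal S (elem b r) := by
  rw [inclReal_apply]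
  exact congrArg (Prod.mk _) (funext fun _ => elem_zero b)

theorem elemG_padic (b : Bool) (p : S) (x : ℚ_[p.1.1]) :
    elemG b ((0, Pi.single p x) : Adeles S) = inclPadic p (elem b x) := by
  rw [inclPadic_apply]
  refine congrArg₂ Prod.mk (elem_zero b) (funext fun q => ?_)
  by_cases h : q = p
  · subst h; rw [Pi.mulSingle_eq_same]; dsimp only; rw [Pi.single_eq_same]
  · rw [Pi.mulSingle_eq_of_ne h]; dsimp only; rw [Pi.single_eq_of_ne h, elem_zero]

/-- Strong approximation at the archimedean place. -/
theorem dense_real (S : Finset Nat.Primes) :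
    (Gam S ⊔ (inclReal S).range).topologicalClosure = ⊤ := by
  refine closure_eq_top fun b => exists_dist_lt_imp_dense fun r x ε hε => ?_
  obtain ⟨z, hz, hzx⟩ := exists_approx_padic x hε
  refine ⟨ratAdele z + (r - (z : ℝ), 0), ?_, ?_, fun p => ?_⟩
  · rw [Set.mem_ofPred_eq, elemG_add, elemG_real]
    exact Subgroup.mul_mem_sup (elemG_mem_Gam b hz) ⟨_, rfl⟩
  · rw [Prod.fst_add, ratAdele_fst, add_sub_cancel, sub_self, abs_zero]
    exact hε
  · rw [Prod.snd_add, Pi.add_apply, ratAdele_snd]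
    change ‖(z : ℚ_[p.1.1]) + 0 - x p‖ < ε
    rw [add_zero]
    exact hzx p

/-- Strong approximation at the place `p`. -/
theorem dense_padic (p : S) : (Gam S ⊔ (inclPadic p).range).topologicalClosure = ⊤ := by
  refine closure_eq_top fun b => exists_dist_lt_imp_dense fun r x ε hε => ?_
  obtain ⟨z, hz, hzr, hzx⟩ := exists_approx_real p r x hε
  refine ⟨ratAdele z + (0, Pi.single p (x p - (z : ℚ_[p.1.1]))), ?_, ?_, fun q => ?_⟩
  · rw [Set.mem_ofPred_eq, elemG_add, elemG_padic]
    exact Subgroup.mul_mem_sup (elemG_mem_Gam b hz) ⟨_, rfl⟩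
  · rw [Prod.fst_add, ratAdele_fst, add_zero]
    exact hzr
  · rw [Prod.snd_add, Pi.add_apply, ratAdele_snd]
    change ‖(z : ℚ_[q.1.1]) + Pi.single (M := fun q : S => ℚ_[q.1.1]) p (x p - z) q - x q‖ < ε
    by_cases h : q = p
    · subst h
      rw [Pi.single_eq_same, add_sub_cancel, sub_self, norm_zero]
      exact hε
    · rw [Pi.single_eq_of_ne h, add_zero]
      exact hzx q h

end StrongApproximation

/-! ### Mixing -/

section Mixing

variable {S : Finset Nat.Primes}

/-- If `g` leaves every compact subset of `G`, one of its components does so. -/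
theorem exists_component_tendsto_cocompact {U : Ultrafilter (G S)} (hU : ↑U ≤ cocompact (G S)) :
    Tendsto (fun g : G S => g.1) U (cocompact _) ∨
      ∃ p : S, Tendsto (fun g : G S => g.2 p) U (cocompact _) := by
  have key : ∀ {Y : Type} [TopologicalSpace Y] (f : G S → Y), ¬ Tendsto f U (cocompact Y) →
      ∃ C, IsCompact C ∧ ∀ᶠ g in (U : Filter (G S)), f g ∈ C := fun {Y} _ f hf => by
    rw [hasBasis_cocompact.tendsto_right_iff] at hf
    push Not at hf
    obtain ⟨C, hC, h⟩ := hf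
    refine ⟨C, hC, ?_⟩
    simpa using h
  by_contra! hcon
  obtain ⟨C, hC, h1⟩ := key _ hcon.1
  choose C' hC' h2 using fun p => key _ (hcon.2 p)
  have h3 := hU (hC.prod (isCompact_univ_pi hC')).compl_mem_cocompact
  have h4 : ∀ᶠ g in (U : Filter (G S)), g ∈ C ×ˢ Set.pi Set.univ C' := by
    filter_upwards [h1, eventually_all.2 h2] with g hg hg'
    exact ⟨hg, fun p _ => hg' p⟩
  obtain ⟨g, hg, hg'⟩ := (h4.and h3).exists
  exact hg' hg

variable [MeasurableSpace (G S)] [BorelSpace (G S)] (μG : Measure (G S)) [μG.IsHaarMeasure]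
  [μG.IsMulRightInvariant] (μX : Measure (X S)) [QuotientMeasureEqMeasurePreimage μG μX]
  [IsFiniteMeasure μX]

/-- The action of `G` on `Γ \ G` is mixing. Some component of `g` goes to infinity along a given
ultrafilter; the weak limit is fixed by the corresponding factor, which acts ergodically by strong
approximation. -/
theorem tendsto_inner_rightRegular {α : Lp ℝ 2 μX} (hα : ∫ x, α x ∂μX = 0) (β : Lp ℝ 2 μX) :
    Tendsto (fun g => inner ℝ (rightRegular μG μX g α) β) (cocompact (G S)) (𝓝 0) := by
  have hρ := norm_rightRegular μG μX
  have hc := continuous_rightRegular μG μX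
  rw [tendsto_iff_ultrafilter]
  intro U hU
  have hw : ∃ w : Lp ℝ 2 μX,
      (∀ β, Tendsto (fun g => inner ℝ (rightRegular μG μX g α) β) U (𝓝 (inner ℝ w β))) ∧
      ∃ c : ℝ, w =ᵐ[μX] fun _ => c := by
    obtain h | ⟨p, h⟩ := exists_component_tendsto_cocompact hU
    · obtain ⟨w, hw1, hw2⟩ := exists_fixed_weak_limit (inclReal S) continuous_inclReal
        (fun g => g.1) inclReal_conj (rightRegular μG μX) hρ hc U h α
      exact ⟨w, hw1, exists_ae_eq_const_of_invariant μG μX (inclReal S) continuous_inclReal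
        (fun g k => ⟨_, inclReal_conj g k⟩) (dense_real S) w hw2⟩
    · obtain ⟨w, hw1, hw2⟩ := exists_fixed_weak_limit (inclPadic p) (continuous_inclPadic p)
        (fun g => g.2 p) (inclPadic_conj p) (rightRegular μG μX) hρ hc U h α
      exact ⟨w, hw1, exists_ae_eq_const_of_invariant μG μX (inclPadic p) (continuous_inclPadic p)
        (fun g k => ⟨_, inclPadic_conj p g k⟩) (dense_padic p) w hw2⟩
  obtain ⟨w, hw, c, hwc⟩ := hw
  -- the weak limit is a constant orthogonal to the constants
  have hint : ∀ f : Lp ℝ 2 μX, inner ℝ f (Lp.const 2 μX (1 : ℝ)) = ∫ x, f x ∂μX := fun f => by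
    rw [L2.inner_def]
    refine integral_congr_ae ?_
    filter_upwards [Lp.coeFn_const (p := 2) (μ := μX) (1 : ℝ)] with x hx
    rw [hx]; simp
  have h1 : inner ℝ w (Lp.const 2 μX (1 : ℝ)) = 0 := by
    refine tendsto_nhds_unique (hw _) (tendsto_const_nhds.congr fun g => ?_)
    have hmp := measurePreserving_rightTranslate μG μX g
    have h2 : ∫ x, α (rightTranslate g x) ∂μX = ∫ x, α x ∂(μX.map (rightTranslate g)) :=
      (integral_map hmp.aemeasurable (Lp.stronglyMeasurable α).aestronglyMeasurable).symm
    rw [hint, integral_congr_ae (rightRegular_coeFn μG μX g α), h2, hmp.map_eq, hα]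
  have hw0 : w = 0 := by
    rw [hint, integral_congr_ae hwc, integral_const, smul_eq_mul, mul_eq_zero] at h1
    have hc0 : c = 0 := h1.resolve_left fun h =>
      (ENNReal.toReal_eq_zero_iff _).1 h |>.elim (measure_univ_ne_zero μG μX) (measure_ne_top _ _)
    refine Lp.ext (hwc.trans ?_)
    rw [hc0]
    exact (Lp.coeFn_zero ℝ 2 μX).symm
  have := hw β
  rwa [hw0, inner_zero_left] at this

end Mixing

end SArith

namespace SArith

open HoweMoore LatticeQuotient

/-! ### Integral elements -/

section Integral

variable {S : Finset Nat.Primes}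

theorem mem_SLZp_iff {p : ℕ} [Fact p.Prime] {g : SL(2, ℚ_[p])} :
    g ∈ SLZp p ↔ ∀ i j, ‖g.1 i j‖ ≤ 1 := by
  constructor
  · rintro ⟨h, rfl⟩ i j
    exact (h.1 i j).2
  · intro h
    let e : Fin 2 → Fin 2 → ℤ_[p] := fun i j => ⟨g.1 i j, h i j⟩
    refine ⟨mk2 (e 0 0) (e 0 1) (e 1 0) (e 1 1) (Subtype.ext (det_eq g)), ?_⟩
    apply ext2 <;> rfl

/-- The elements of `G` whose components at the primes in `S` are integral. -/
def integral (S : Finset Nat.Primes) : Set (G S) := {g | ∀ p : S, g.2 p ∈ SLZp p.1.1}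

theorem isOpen_SLZp (p : ℕ) [Fact p.Prime] : IsOpen (SLZp p : Set SL(2, ℚ_[p])) := by
  have : (SLZp p : Set SL(2, ℚ_[p])) =
      ⋂ i, ⋂ j, {g | g.1 i j ∈ Metric.closedBall (0 : ℚ_[p]) 1} := by
    ext g
    simp only [SetLike.mem_coe, mem_SLZp_iff, Set.mem_iInter]
    exact forall_congr' fun i => forall_congr' fun j => mem_closedBall_zero_iff.symm
  rw [this]
  exact isOpen_iInter_of_finite fun i => isOpen_iInter_of_finite fun j =>
    (IsUltrametricDist.isOpen_closedBall _ one_ne_zero).preimage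
      (continuous_subtype_val.matrix_elem i j)

theorem isCompact_SLZp (p : ℕ) [Fact p.Prime] : IsCompact (SLZp p : Set SL(2, ℚ_[p])) := by
  have : (SLZp p : Set SL(2, ℚ_[p])) = {A | ∀ i j, ‖A i j‖ ≤ 1} := Set.ext fun g => mem_SLZp_iff
  rw [this]
  exact isCompact_norm_le 1

theorem isOpen_integral : IsOpen (integral S) := by
  have : integral S = ⋂ p : S, (fun g : G S => g.2 p) ⁻¹' (SLZp p.1.1) := by
    ext g; simp [integral]
  rw [this]
  exact isOpen_iInter_of_finite fun p => (isOpen_SLZp p.1.1).preimage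
    ((continuous_apply p).comp continuous_snd)

theorem mul_mem_integral {g h : G S} (hg : g ∈ integral S) (hh : h ∈ integral S) :
    g * h ∈ integral S := fun p => mul_mem (hg p) (hh p)

/-- A set of integral elements whose real components are bounded is relatively compact. -/
theorem exists_compact_of_bounded (R : ℝ) :
    ∃ K : Set (G S), IsCompact K ∧ ∀ g ∈ integral S, (∀ i j, |g.1.1 i j| ≤ R) → g ∈ K :=
  ⟨{A : SL(2, ℝ) | ∀ i j, ‖A i j‖ ≤ R} ×ˢ Set.pi Set.univ fun p : S => SLZp p.1.1,
    (isCompact_norm_le R).prod (isCompact_univ_pi fun p => isCompact_SLZp p.1.1),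
    fun _ hg h => ⟨h, fun p _ => hg p⟩⟩

/-- `G = Γ · (SL₂(ℝ) × ∏_{p ∈ S} SL₂(ℤ_p))`, as `Γ · SL₂(ℝ)` is dense. -/
theorem exists_mul_mem_integral (g : G S) : ∃ γ : Gam S, (γ : G S) * g ∈ integral S := by
  have hn : (inclReal S).range.Normal := ⟨by
    rintro _ ⟨x, rfl⟩ g
    have := inclReal_conj g⁻¹ x
    rw [inv_inv] at this
    exact ⟨_, this.symm⟩⟩
  have ho : IsOpen ((· * g) ⁻¹' integral S) := isOpen_integral.preimage (continuous_mul_const g)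
  have hd : Dense ((Gam S ⊔ (inclReal S).range : Subgroup (G S)) : Set (G S)) := by
    rw [dense_iff_closure_eq, ← Subgroup.topologicalClosure_coe, dense_real]; rfl
  obtain ⟨h, hh, hmem⟩ := hd.exists_mem_open ho ⟨g⁻¹, by
    change g⁻¹ * g ∈ integral S
    rw [inv_mul_cancel]
    exact fun p => one_mem _⟩
  rw [Subgroup.mul_normal] at hh
  obtain ⟨γ, hγ, _, ⟨x, rfl⟩, rfl⟩ := hh
  refine ⟨⟨γ, hγ⟩, fun p => ?_⟩
  have h1 := hmem p
  change γ.2 p * (1 : (p : S) → SL(2, ℚ_[p.1.1])) p * g.2 p ∈ _ at h1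
  rwa [Pi.one_apply, mul_one] at h1

end Integral

/-! ### Siegel sets and finite covolume -/

section Siegel

/-- The imaginary part of `g • i` is `1 / den g`. -/
def den (g : SL(2, ℝ)) : ℝ := g.1 1 0 ^ 2 + g.1 1 1 ^ 2

/-- The real part of `g • i` is `num g / den g`. -/
def num (g : SL(2, ℝ)) : ℝ := g.1 0 0 * g.1 1 0 + g.1 0 1 * g.1 1 1

theorem den_pos (g : SL(2, ℝ)) : 0 < den g := by
  have := det_eq g
  by_contra h
  have h0 : g.1 1 0 = 0 := by unfold den at h; nlinarith [sq_nonneg (g.1 1 0), sq_nonneg (g.1 1 1)]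
  have h1 : g.1 1 1 = 0 := by unfold den at h; nlinarith [sq_nonneg (g.1 1 0), sq_nonneg (g.1 1 1)]
  rw [h0, h1] at this
  simp at this

theorem num_sq_add_one (g : SL(2, ℝ)) : num g ^ 2 + 1 = (g.1 0 0 ^ 2 + g.1 0 1 ^ 2) * den g := by
  have := det_eq g
  unfold num den
  linear_combination -(g.1 0 0 * g.1 1 1 - g.1 0 1 * g.1 1 0 + 1) * this

theorem den_upperUnip_mul (t : ℝ) (g : SL(2, ℝ)) : den (upperUnip t * g) = den g := by
  simp only [den, mul_entry]; simp [upperUnip]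

theorem num_upperUnip_mul (t : ℝ) (g : SL(2, ℝ)) :
    num (upperUnip t * g) = num g + t * den g := by
  simp only [num, den, mul_entry]; simp [upperUnip]; ring

theorem continuous_den : Continuous den := by
  have h : ∀ i j, Continuous fun g : SL(2, ℝ) => g.1 i j :=
    fun i j => continuous_subtype_val.matrix_elem i j
  exact ((h 1 0).pow 2).add ((h 1 1).pow 2)

theorem continuous_num : Continuous num := by
  have h : ∀ i j, Continuous fun g : SL(2, ℝ) => g.1 i j :=
    fun i j => continuous_subtype_val.matrix_elem i j
  exact ((h 0 0).mul (h 1 0)).add ((h 0 1).mul (h 1 1))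

theorem den_mul_im (g : SL(2, ℝ)) : den g * (g • UpperHalfPlane.I).im = 1 := by
  have h0 := (den_pos g).ne'
  have hd := det_eq g
  unfold den at *
  rw [← UpperHalfPlane.coe_im, UpperHalfPlane.coe_specialLinearGroup_apply, Complex.div_im]
  simp [Complex.normSq_apply]
  field_simp
  grind

/-- Real part of the reduction theory of `SL₂(ℤ)`: every element of `SL₂(ℝ)` can be moved into the
standard Siegel set. -/
theorem exists_int_mul_mem_siegel (g : SL(2, ℝ)) : ∃ A : SL(2, ℤ),
    let h := Matrix.SpecialLinearGroup.map (Int.castRingHom ℝ) A * g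
    den h ≤ 2 ∧ 0 ≤ num h ∧ num h < den h := by
  obtain ⟨A, hA⟩ := ModularGroup.exists_one_half_le_im_smul (g • UpperHalfPlane.I)
  set g' := Matrix.SpecialLinearGroup.map (Int.castRingHom ℝ) A * g
  have h1 : A • g • UpperHalfPlane.I = g' • UpperHalfPlane.I := by
    rw [mul_smul, UpperHalfPlane.ext_iff, UpperHalfPlane.coe_specialLinearGroup_apply A,
      UpperHalfPlane.coe_specialLinearGroup_apply (Matrix.SpecialLinearGroup.map _ A)]
    simp
  rw [h1] at hA
  have h2 := den_mul_im g'
  have h3 := den_pos g'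
  refine ⟨upperUnip (-⌊num g' / den g'⌋) * A, ?_⟩
  have h4 : Matrix.SpecialLinearGroup.map (Int.castRingHom ℝ) (upperUnip (-⌊num g' / den g'⌋) * A) *
      g = upperUnip (-(⌊num g' / den g'⌋ : ℝ)) * g' := by
    rw [map_mul, mul_assoc]
    congr 1
    apply ext2 <;> simp [upperUnip]
  intro h
  have h5 : h = upperUnip (-(⌊num g' / den g'⌋ : ℝ)) * g' := h4
  rw [h5, den_upperUnip_mul, num_upperUnip_mul]
  refine ⟨by nlinarith, ?_, ?_⟩
  · have := (le_div_iff₀ h3).1 (Int.floor_le (num g' / den g'))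
    linarith
  · have := (div_lt_iff₀ h3).1 (Int.lt_floor_add_one (num g' / den g'))
    linarith

variable {S : Finset Nat.Primes}

/-- The integral elements `g` of `G` such that `g_∞ • i = x + i y` with `0 ≤ x < w` and
`1 / t ≤ y < 1 / s`. -/
def siegelPiece (S : Finset Nat.Primes) (w s t : ℝ) : Set (G S) :=
  {g | g ∈ integral S ∧ s < den g.1 ∧ den g.1 ≤ t ∧ 0 ≤ num g.1 ∧ num g.1 < w * den g.1}

/-- The Siegel set `0 ≤ x < 1`, `1 / 2 ≤ y` meets every `Γ`-orbit in `G`. -/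
theorem exists_mul_mem_siegel (g : G S) : ∃ γ : Gam S, (γ : G S) * g ∈ siegelPiece S 1 0 2 := by
  obtain ⟨γ, hγ⟩ := exists_mul_mem_integral g
  obtain ⟨A, hA⟩ := exists_int_mul_mem_siegel ((γ : G S) * g).1
  let B : SL(2, SInt S) := Matrix.SpecialLinearGroup.map (Int.castRingHom _) A
  have hB : (diag S B).1 = Matrix.SpecialLinearGroup.map (Int.castRingHom ℝ) A := by
    ext i j
    rw [diag_real]
    simp [B]
  refine ⟨⟨diag S B, B, rfl⟩ * γ, ?_⟩
  have h1 : ((⟨diag S B, B, rfl⟩ * γ : Gam S) : G S) * g = diag S B * ((γ : G S) * g) :=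
    mul_assoc _ _ _
  rw [h1]
  refine ⟨mul_mem_integral (fun p => mem_SLZp_iff.2 fun i j => ?_) hγ, den_pos _, ?_⟩
  · rw [diag_padic]
    have : ((B.1 i j : ℚ) : ℚ_[p.1.1]) = ((A.1 i j : ℤ) : ℚ_[p.1.1]) := by simp [B]
    rw [this]
    exact Padic.norm_int_le_one _
  · rw [Prod.fst_mul, hB, one_mul]
    exact hA

theorem exists_compact_siegelPiece {w s t : ℝ} (hs : 0 < s) :
    ∃ K : Set (G S), IsCompact K ∧ siegelPiece S w s t ⊆ K := by
  obtain ⟨K, hK, h⟩ := exists_compact_of_bounded (S := S) (1 + t + ((w * t) ^ 2 + 1) / s)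
  refine ⟨K, hK, fun g ⟨hg, h1, h2, h3, h4⟩ => h g hg ?_⟩
  have h5 := num_sq_add_one g.1
  have hw : 0 ≤ w := by
    by_contra! hw
    nlinarith
  have h6 : num g.1 ≤ w * t := h4.le.trans (by gcongr)
  have h7 : g.1.1 0 0 ^ 2 + g.1.1 0 1 ^ 2 ≤ ((w * t) ^ 2 + 1) / s := by
    rw [le_div_iff₀ hs]
    nlinarith [sq_nonneg (g.1.1 0 0), sq_nonneg (g.1.1 0 1)]
  have h8 : g.1.1 1 0 ^ 2 + g.1.1 1 1 ^ 2 ≤ t := h2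
  have hb : ∀ x : ℝ, x ^ 2 ≤ t + ((w * t) ^ 2 + 1) / s →
      |x| ≤ 1 + t + ((w * t) ^ 2 + 1) / s := fun x hx => by
    nlinarith [sq_nonneg (|x| - 1), sq_abs x]
  have h9 : 0 ≤ ((w * t) ^ 2 + 1) / s := by positivity
  have h10 : 0 ≤ t := (hs.trans (h1.trans_le h2)).le
  intro i j
  apply hb
  fin_cases i <;> fin_cases j <;>
    simp only [Fin.zero_eta, Fin.mk_one] <;>
    nlinarith [sq_nonneg (g.1.1 0 0), sq_nonneg (g.1.1 0 1), sq_nonneg (g.1.1 1 0),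
      sq_nonneg (g.1.1 1 1)]

variable [MeasurableSpace (G S)] [BorelSpace (G S)]

theorem measurableSet_siegelPiece (w s t : ℝ) : MeasurableSet (siegelPiece S w s t) := by
  have hd : Continuous fun g : G S => den g.1 := continuous_den.comp continuous_fst
  have hn : Continuous fun g : G S => num g.1 := continuous_num.comp continuous_fst
  refine isOpen_integral.measurableSet.inter ?_
  refine (isOpen_lt continuous_const hd).measurableSet.inter ?_
  refine (isClosed_le hd continuous_const).measurableSet.inter ?_
  refine (isClosed_le continuous_const hn).measurableSet.inter ?_
  exact (isOpen_lt hn (continuous_const.mul hd)).measurableSet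

variable (μ : Measure (G S)) [μ.IsHaarMeasure]

/-- Translation by the diagonal matrix `(r, r⁻¹)` scales `x` and `y` by `r ^ 2`. -/
theorem measure_siegelPiece_le_scale {r : ℝ} (hr : 0 < r) (w s t : ℝ) :
    μ (siegelPiece S w s t) ≤ μ (siegelPiece S (w * r ^ 2) (s / r ^ 2) (t / r ^ 2)) := by
  let a : SL(2, ℝ) := mk2 r 0 0 r⁻¹ (by field_simp; ring)
  rw [← measure_preimage_mul μ (inclReal S a) (siegelPiece S (w * r ^ 2) (s / r ^ 2) (t / r ^ 2))]
  refine measure_mono fun g ⟨hg, h1, h2, h3, h4⟩ => ?_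
  have h5 : den (a * g.1) = den g.1 / r ^ 2 := by
    simp only [den, mul_entry]; simp [a]; field_simp
  have h6 : num (a * g.1) = num g.1 := by
    simp only [num, mul_entry]; simp [a]; field_simp
  refine ⟨mul_mem_integral (fun p => one_mem _) hg, ?_⟩
  change _ < den (a * g.1) ∧ den (a * g.1) ≤ _ ∧ 0 ≤ num (a * g.1) ∧
    num (a * g.1) < _ * den (a * g.1)
  rw [h5, h6]
  refine ⟨by gcongr, by gcongr, h3, ?_⟩
  convert h4 using 1
  field_simp

/-- A strip of width `1 / N` has `N` disjoint translates in the strip of width `1`. -/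
theorem mul_measure_siegelPiece_le {N : ℕ} (hN : 0 < N) (s t : ℝ) :
    N * μ (siegelPiece S (1 / N) s t) ≤ μ (siegelPiece S 1 s t) := by
  let n : ℕ → G S := fun j => inclReal S (upperUnip (-(j / N : ℝ)))
  have hN' : (0 : ℝ) < N := Nat.cast_pos.2 hN
  have hmem : ∀ j g, g ∈ (n j * ·) ⁻¹' siegelPiece S (1 / N) s t → g ∈ integral S ∧
      s < den g.1 ∧ den g.1 ≤ t ∧ j * den g.1 ≤ N * num g.1 ∧
      N * num g.1 < (j + 1) * den g.1 := by
    rintro j g ⟨h1, h2⟩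
    change _ < den (upperUnip _ * g.1) ∧ den (upperUnip _ * g.1) ≤ _ ∧ 0 ≤ num (upperUnip _ * g.1) ∧
      num (upperUnip _ * g.1) < _ * den (upperUnip _ * g.1) at h2
    rw [den_upperUnip_mul, num_upperUnip_mul] at h2
    obtain ⟨h2, h3, h4, h5⟩ := h2
    refine ⟨fun p => by simpa [n, inclReal_apply] using h1 p, h2, h3, ?_, ?_⟩
    · field_simp at h4; linarith
    · field_simp at h5; linarith
  have hdisj : Set.PairwiseDisjoint (Finset.range N : Set ℕ)
      fun j => (n j * ·) ⁻¹' siegelPiece S (1 / N) s t := by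
    intro i _ j _ hij
    refine Set.disjoint_left.2 fun g hi hj => hij ?_
    obtain ⟨-, -, -, h1, h2⟩ := hmem i g hi
    obtain ⟨-, -, -, h3, h4⟩ := hmem j g hj
    have h5 := den_pos g.1
    have h6 : (i : ℝ) < j + 1 := lt_of_mul_lt_mul_right (h1.trans_lt h4) h5.le
    have h7 : (j : ℝ) < i + 1 := lt_of_mul_lt_mul_right (h3.trans_lt h2) h5.le
    have h8 : i < j + 1 := by exact_mod_cast h6
    have h9 : j < i + 1 := by exact_mod_cast h7
    omega
  have hsub : (⋃ j ∈ Finset.range N, (n j * ·) ⁻¹' siegelPiece S (1 / N) s t) ⊆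
      siegelPiece S 1 s t := by
    refine Set.iUnion₂_subset fun j hj g hg => ?_
    obtain ⟨h0, h1, h2, h3, h4⟩ := hmem j g hg
    have h5 := den_pos g.1
    have hj' : (j : ℝ) + 1 ≤ N := by exact_mod_cast Finset.mem_range.1 hj
    have h6 : 0 ≤ N * num g.1 := le_trans (by positivity) h3
    refine ⟨h0, h1, h2, (mul_nonneg_iff_of_pos_left hN').1 h6, ?_⟩
    rw [one_mul]
    exact lt_of_mul_lt_mul_left (h4.trans_le (by gcongr)) hN'.le
  have h1 := measure_mono (μ := μ) hsub
  rw [measure_biUnion_finset hdisj fun j _ =>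
    (measurableSet_siegelPiece _ _ _).preimage (measurable_const_mul _)] at h1
  simpa [measure_preimage_mul] using h1

/-- The Siegel set `0 ≤ x < 1`, `1 / 2 ≤ y` has finite measure: its part with `y` of size `4 ^ k`
is moved by a diagonal matrix to a strip of width `4 ^ (-k)` at bounded height, so that its measure
is `O(4 ^ (-k))`. -/
theorem measure_siegelPiece_lt_top : μ (siegelPiece S 1 0 2) < ⊤ := by
  have hfin : μ (siegelPiece S 1 (1 / 2) 2) < ⊤ := by
    obtain ⟨K, hK, h⟩ := exists_compact_siegelPiece (S := S) (w := 1) (s := 1 / 2) (t := 2)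
      (by norm_num)
    exact (measure_mono h).trans_lt hK.measure_lt_top
  have hcover : siegelPiece S 1 0 2 ⊆
      ⋃ k : ℕ, siegelPiece S 1 (1 / 2 * (1 / 4) ^ k) (2 * (1 / 4) ^ k) := by
    rintro g ⟨h0, h1, h2, h3⟩
    obtain ⟨k, hk1, hk2⟩ := exists_nat_pow_near_of_lt_one (x := den g.1 / 2) (y := 1 / 4)
      (by positivity) (by linarith) (by norm_num) (by norm_num)
    refine Set.mem_iUnion.2 ⟨k, h0, ?_, ?_, h3⟩
    · rw [pow_succ] at hk1; linarith
    · linarith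
  have hk : ∀ k : ℕ, μ (siegelPiece S 1 (1 / 2 * (1 / 4) ^ k) (2 * (1 / 4) ^ k)) ≤
      (1 / 4) ^ k * μ (siegelPiece S 1 (1 / 2) 2) := fun k => by
    refine (measure_siegelPiece_le_scale μ (r := (1 / 2) ^ k) (by positivity) _ _ _).trans ?_
    have h4 : (((1 : ℝ) / 2) ^ k) ^ 2 = (1 / 4) ^ k := by
      rw [← pow_mul, mul_comm, pow_mul]; norm_num
    have h5 : ((1 : ℝ) / 4) ^ k ≠ 0 := by positivity
    rw [h4, mul_div_cancel_right₀ _ h5, mul_div_cancel_right₀ _ h5, one_mul]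
    have h6 := mul_measure_siegelPiece_le (S := S) μ (N := 4 ^ k) (by positivity) (1 / 2) 2
    push_cast at h6
    rw [one_div_pow, one_div (4 : ENNReal), ← ENNReal.inv_pow, ← ENNReal.div_eq_inv_mul]
    rw [ENNReal.le_div_iff_mul_le (by simp) (by simp), mul_comm]
    exact h6
  refine (measure_mono hcover).trans_lt ((measure_iUnion_le _).trans_lt ?_)
  refine (ENNReal.tsum_le_tsum hk).trans_lt ?_
  rw [ENNReal.tsum_mul_right, ENNReal.tsum_geometric]
  refine ENNReal.mul_lt_top ?_ hfin
  rw [ENNReal.inv_lt_top, tsub_pos_iff_lt]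
  rw [one_div]
  exact ENNReal.inv_lt_one.2 (by norm_num)

/-- `SL₂(ℤ_S)` has finite covolume. -/
theorem measure_univ_lt_top (μX : Measure (X S)) [QuotientMeasureEqMeasurePreimage μ μX] :
    μX Set.univ < ⊤ :=
  (measure_univ_le μ μX exists_mul_mem_siegel).trans_lt (measure_siegelPiece_lt_top μ)

end Siegel

end SArith

namespace LatticeQuotient

/-! ### Uniform continuity on the quotient -/

section UniformContinuity

variable {G : Type*} [Group G] {Γ : Subgroup G}

theorem rightTranslate_one (x : LeftQuotient Γ) : rightTranslate 1 x = x := by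
  induction x using Quotient.inductionOn with
  | h g => exact congrArg (proj Γ) (mul_one g)

theorem rightTranslate_inv_rightTranslate (g : G) (x : LeftQuotient Γ) :
    rightTranslate g⁻¹ (rightTranslate g x) = x := by
  induction x using Quotient.inductionOn with
  | h y => exact congrArg (proj Γ) (mul_inv_cancel_right y g)

variable [TopologicalSpace G] [IsTopologicalGroup G] [PolishSpace G]
  [LocallyCompactSpace G] [DiscreteTopology Γ]

/-- Compactly supported continuous functions on `Γ \ G` are uniformly continuous for the right
action of `G`. -/
theorem eventually_abs_rightTranslate_sub_lt (α : C_c(LeftQuotient Γ, ℝ)) {ε : ℝ} (hε : 0 < ε) :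
    ∀ᶠ v in 𝓝 (1 : G), ∀ x, |α (rightTranslate v x) - α x| < ε := by
  have hc := continuous_rightTranslate_uncurry Γ
  obtain ⟨W, hW, hW1⟩ := exists_compact_mem_nhds (1 : G)
  -- outside this compact set `α` vanishes at `x` and at its translate by `v`, for `v` near `1`
  let K : Set (LeftQuotient Γ) :=
    (fun p : G × LeftQuotient Γ => rightTranslate p.1⁻¹ p.2) '' (W ×ˢ tsupport α)
  have hK : IsCompact K := (hW.prod α.hasCompactSupport.isCompact).image
    (hc.comp (continuous_fst.inv.prodMk continuous_snd))
  have h1 : ∀ᶠ v in 𝓝 (1 : G), ∀ x ∈ K, |α (rightTranslate v x) - α x| < ε := by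
    refine hK.eventually_forall_of_forall_eventually fun x _ => ?_
    have h2 : Continuous fun p : G × LeftQuotient Γ => |α (rightTranslate p.1 p.2) - α p.2| :=
      ((α.continuous.comp hc).sub (α.continuous.comp continuous_snd)).abs
    refine h2.continuousAt.eventually_lt continuousAt_const ?_
    change |α (rightTranslate 1 x) - α x| < ε
    rwa [rightTranslate_one, sub_self, abs_zero]
  filter_upwards [h1, hW1] with v hv hvW x
  by_cases hx : x ∈ K
  · exact hv x hx
  · have h3 : α x = 0 := image_eq_zero_of_notMem_tsupport fun h => hx
      ⟨(1, x), ⟨mem_of_mem_nhds hW1, h⟩, by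
        simp only [inv_one, rightTranslate_one]⟩
    have h4 : α (rightTranslate v x) = 0 := image_eq_zero_of_notMem_tsupport fun h => hx
      ⟨(v, rightTranslate v x), ⟨hvW, h⟩, rightTranslate_inv_rightTranslate v x⟩
    rwa [h3, h4, sub_self, abs_zero]

end UniformContinuity

/-! ### Averages over a compact subgroup -/

section Averaging

variable {G : Type*} [Group G] [TopologicalSpace G] [IsTopologicalGroup G] [PolishSpace G]
  [MeasurableSpace G] [BorelSpace G] {H : Subgroup G} (ν : Measure H) [IsProbabilityMeasure ν]

/-- The average of `f` over the left translates of `g` by the elements of `H`. -/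
def avg (f : G → ℝ) (g : G) : ℝ := ∫ h : H, f (h * g) ∂ν

theorem avg_mul_left [ν.IsMulRightInvariant] (f : G → ℝ) (h : H) (g : G) :
    avg ν f (h * g) = avg ν f g := by
  refine Eq.trans ?_ (integral_mul_right_eq_self (fun k : H => f (k * g)) h)
  simp only [avg, Subgroup.coe_mul, mul_assoc]

variable {f : G → ℝ} (hf : Continuous f) {C : ℝ} (hC : ∀ g, |f g| ≤ C)
include hf hC

theorem integrable_comp_mul (g : G) : Integrable (fun h : H => f (h * g)) ν :=
  Integrable.of_bound (by
    have : Continuous fun h : H => f (h * g) := by fun_prop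
    exact this.aestronglyMeasurable) C (ae_of_all _ fun h => hC _)

theorem abs_avg_sub_avg_le {x y : G} {ε : ℝ} (h : ∀ k : H, |f (k * x) - f (k * y)| ≤ ε) :
    |avg ν f x - avg ν f y| ≤ ε := by
  rw [avg, avg, ← integral_sub (integrable_comp_mul ν hf hC x) (integrable_comp_mul ν hf hC y)]
  simpa using norm_integral_le_of_norm_le_const (μ := ν)
    (f := fun k : H => f (k * x) - f (k * y)) (ae_of_all _ h)

omit hf [IsTopologicalGroup G] [PolishSpace G] [BorelSpace G] in
theorem abs_avg_le (g : G) : |avg ν f g| ≤ C := by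
  simpa [avg] using norm_integral_le_of_norm_le_const (μ := ν) (f := fun h : H => f (h * g))
    (ae_of_all _ fun h => hC _)

omit hC in
theorem stronglyMeasurable_avg : StronglyMeasurable (avg ν f) := by
  have h : Continuous fun p : G × H => f (p.2 * p.1) := by fun_prop
  exact h.stronglyMeasurable.integral_prod_right (f := fun g (h : H) => f (h * g))

/-- Testing a left `H`-invariant function against `f` or against the `H`-average of `f` gives the
same result. -/
theorem integral_mul_avg {μ : Measure G} [SFinite μ] [μ.IsMulLeftInvariant] {φ : G → ℝ}
    (hφ : Integrable φ μ) (hφH : ∀ h ∈ H, ∀ g, φ (h * g) = φ g) :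
    ∫ g, φ g * avg ν f g ∂μ = ∫ g, φ g * f g ∂μ := by
  have hc : Continuous fun p : G × H => f (p.2 * p.1) := by fun_prop
  have hi : Integrable (Function.uncurry fun (g : G) (h : H) => φ g * f (h * g)) (μ.prod ν) :=
    (hφ.comp_fst ν).mul_bdd hc.aestronglyMeasurable (ae_of_all _ fun p => hC _)
  calc ∫ g, φ g * avg ν f g ∂μ = ∫ g, ∫ h : H, φ g * f (h * g) ∂ν ∂μ := by
        simp only [avg, integral_const_mul]
    _ = ∫ h : H, ∫ g, φ g * f (h * g) ∂μ ∂ν := integral_integral_swap hi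
    _ = ∫ _ : H, ∫ g, φ g * f g ∂μ ∂ν := by
        refine integral_congr_ae (ae_of_all _ fun h => ?_)
        refine Eq.trans ?_ (integral_mul_left_eq_self (fun g => φ g * f g) (h : G))
        simp only [hφH h h.2]
    _ = ∫ g, φ g * f g ∂μ := by simp

end Averaging

/-! ### Counting orbit points in compact sets -/

section Indicator

variable {G : Type*} [Group G] [TopologicalSpace G] [IsTopologicalGroup G] [T2Space G]
  {Γ : Subgroup G} [DiscreteTopology Γ]

/-- The number of points of a `Γ`-orbit in a relatively compact set is bounded independently of the
orbit. -/
theorem exists_automorphize_indicator_le {O K : Set G} (hK : IsCompact K) (hO : O ⊆ K) :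
    ∃ C : ℝ, ∀ x : LeftQuotient Γ, |MulAction.automorphize (O.indicator 1 : G → ℝ) x| ≤ C := by
  classical
  have hfin := finite_inter_compact (Γ := Γ) (hK.mul hK.inv)
  refine ⟨hfin.toFinset.card, fun x => ?_⟩
  induction x using Quotient.inductionOn with
  | h g =>
    change |∑' γ : Γ, (O.indicator 1 (γ * g) : ℝ)| ≤ _
    have h01 : ∀ y, 0 ≤ (O.indicator 1 y : ℝ) := Set.indicator_nonneg fun _ _ => zero_le_one
    rw [abs_of_nonneg (tsum_nonneg fun γ => h01 _)]
    by_cases h : ∃ γ₀ : Γ, (γ₀ : G) * g ∈ O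
    · obtain ⟨γ₀, h0⟩ := h
      rw [tsum_eq_sum (s := hfin.toFinset.image (· * γ₀)) fun γ hγ => ?_]
      · refine (Finset.sum_le_card_nsmul _ _ 1 fun γ _ =>
          Set.indicator_le_self' (fun _ _ => zero_le_one) _).trans ?_
        rw [nsmul_one]
        exact_mod_cast Finset.card_image_le
      · refine Set.indicator_of_notMem (fun h1 => hγ ?_) _
        refine Finset.mem_image.2 ⟨γ * γ₀⁻¹, hfin.mem_toFinset.2 ?_, by simp⟩
        refine ⟨γ * g, hO h1, (γ₀ * g)⁻¹, Set.inv_mem_inv.2 (hO h0), ?_⟩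
        change (γ : G) * g * (γ₀ * g)⁻¹ = γ * (γ₀ : G)⁻¹
        group
    · push Not at h
      simp [Set.indicator_of_notMem (h _)]

end Indicator

end LatticeQuotient

namespace SArith

open HoweMoore LatticeQuotient

/-! ### Equidistribution of translates -/

section Equidistribution

variable {S : Finset Nat.Primes} [MeasurableSpace (G S)] [BorelSpace (G S)] (μG : Measure (G S))
  [μG.IsHaarMeasure] [μG.IsMulRightInvariant] (μX : Measure (X S))
  [QuotientMeasureEqMeasurePreimage μG μX] [IsFiniteMeasure μX]

/-- Equidistribution in `Γ \ G` of the translates of a fixed relatively compact set. -/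
theorem tendsto_setIntegral_translate {O K : Set (G S)} (hO : MeasurableSet O) (hK : IsCompact K)
    (hOK : O ⊆ K) (α : C_c(X S, ℝ)) :
    Tendsto (fun g => ∫ x in O, α (proj (Gam S) (x * g)) ∂μG) (cocompact (G S))
      (𝓝 ((∫ x, α x ∂μX) / μX.real Set.univ * μG.real O)) := by
  set m : ℝ := (∫ x, α x ∂μX) / μX.real Set.univ
  have hX0 : μX.real Set.univ ≠ 0 := fun h => (ENNReal.toReal_eq_zero_iff _).1 h |>.elim
    (measure_univ_ne_zero μG μX) (measure_ne_top _ _)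
  obtain ⟨C, hC⟩ : ∃ C, ∀ x, |α x| ≤ C := by
    obtain ⟨C, hC⟩ := α.hasCompactSupport.exists_bound_of_continuous α.continuous
    exact ⟨C, hC⟩
  have hOfin : μG O ≠ ⊤ := ((measure_mono hOK).trans_lt hK.measure_lt_top).ne
  have hf : Integrable (O.indicator 1 : G S → ℝ) μG :=
    (integrable_indicator_iff hO).2 (integrableOn_const hOfin)
  have hf0 : ∀ g, 0 ≤ (O.indicator 1 : G S → ℝ) g :=
    Set.indicator_nonneg fun _ _ => zero_le_one
  obtain ⟨N, hN⟩ := exists_automorphize_indicator_le (Γ := Gam S) hK hOK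
  have hFm : Measurable (MulAction.automorphize (O.indicator 1 : G S → ℝ) : X S → ℝ) :=
    measurable_automorphize (measurable_one.indicator hO) hf0
  have hF : MemLp (MulAction.automorphize (O.indicator 1 : G S → ℝ) : X S → ℝ) 2 μX :=
    .of_bound hFm.aestronglyMeasurable N (ae_of_all _ hN)
  have hαm : Measurable fun x : X S => α x - m := α.continuous.measurable.sub_const m
  have hαC : ∀ x, |α x - m| ≤ C + |m| := fun x => (abs_sub _ _).trans (by gcongr; exact hC x)
  have hα : MemLp (fun x : X S => α x - m) 2 μX :=
    .of_bound hαm.aestronglyMeasurable (C + |m|) (ae_of_all _ hαC)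
  have hαi : Integrable (fun x : X S => α x) μX :=
    .of_bound α.continuous.measurable.aestronglyMeasurable C (ae_of_all _ hC)
  have hα0 : ∫ x, (hα.toLp _ : X S → ℝ) x ∂μX = 0 := by
    rw [integral_congr_ae hα.coeFn_toLp, integral_sub hαi (integrable_const _), integral_const,
      smul_eq_mul]
    simp only [m]
    field_simp
    ring
  have hlim := tendsto_inner_rightRegular μG μX hα0 (hF.toLp _)
  have hinner : ∀ g, inner ℝ (rightRegular μG μX g (hα.toLp _)) (hF.toLp _) =
      ∫ x in O, α (proj (Gam S) (x * g)) ∂μG - m * μG.real O := fun g => by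
    have h1 : inner ℝ (rightRegular μG μX g (hα.toLp _)) (hF.toLp _) =
        ∫ x, MulAction.automorphize (O.indicator 1 : G S → ℝ) x *
          (α (rightTranslate g x) - m) ∂μX := by
      rw [L2.inner_def]
      refine integral_congr_ae ?_
      filter_upwards [rightRegular_coeFn μG μX g (hα.toLp _), hF.coeFn_toLp,
        (measurePreserving_rightTranslate μG μX g).quasiMeasurePreserving.ae hα.coeFn_toLp]
        with x h1 h2 h3
      rw [h1, h2, h3]
      simp
    have h2 := (unfolding μG μX hf hf0 (α := fun x => α (rightTranslate g x) - m)
      (hαm.comp (continuous_rightTranslate (Gam S) g).measurable) fun x => hαC _).2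
    have h3 : ∀ y, (O.indicator 1 y : ℝ) * (α (rightTranslate g (proj (Gam S) y)) - m) =
        O.indicator (fun y => α (proj (Gam S) (y * g)) - m) y := fun y => by
      by_cases hy : y ∈ O <;> simp [hy]
    rw [h1, h2, integral_congr_ae (ae_of_all _ h3), integral_indicator hO, integral_sub,
      integral_const]
    · simp [mul_comm]
    · have : IsFiniteMeasure (μG.restrict O) := ⟨by simpa using hOfin.lt_top⟩
      refine .of_bound (Continuous.aestronglyMeasurable ?_) C (ae_of_all _ fun y => hC _)
      exact α.continuous.comp ((continuous_proj (Gam S)).comp (continuous_mul_const g))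
    · exact integrableOn_const hOfin
  simp only [hinner] at hlim
  simpa using hlim.add_const (m * μG.real O)

end Equidistribution

end SArith

namespace SArith

open HoweMoore LatticeQuotient

/-! ### Decompositions of `SL₂(ℝ)` -/

section Rotations

theorem mem_SO2_iff {k : SL(2, ℝ)} : k ∈ SO2 ↔ k.1 0 0 = k.1 1 1 ∧ k.1 0 1 = -k.1 1 0 := by
  have hd := det_eq k
  have hT : ∀ i j, (k.transpose).1 i j = k.1 j i := fun i j => rfl
  constructor
  · intro h
    have h' : k.transpose * k = 1 := h
    have e : ∀ i j, k.1 0 i * k.1 0 j + k.1 1 i * k.1 1 j = (1 : SL(2, ℝ)).1 i j := fun i j => by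
      rw [← h', mul_entry, hT, hT]
    have e00 := e 0 0
    have e11 := e 1 1
    simp at e00 e11
    have h0 : (k.1 0 0 - k.1 1 1) ^ 2 + (k.1 0 1 + k.1 1 0) ^ 2 = 0 := by
      linear_combination e00 + e11 - 2 * hd
    constructor <;> nlinarith [sq_nonneg (k.1 0 0 - k.1 1 1), sq_nonneg (k.1 0 1 + k.1 1 0)]
  · rintro ⟨h1, h2⟩
    change k.transpose * k = 1
    simp only [h1, h2] at hd
    apply ext2 <;> rw [mul_entry, hT, hT] <;> simp only [h1, h2] <;> simp <;> linarith

theorem SO2_sq {k : SL(2, ℝ)} (hk : k ∈ SO2) : k.1 0 0 ^ 2 + k.1 1 0 ^ 2 = 1 := by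
  obtain ⟨h1, h2⟩ := mem_SO2_iff.1 hk
  have hd := det_eq k
  rw [← h1, h2] at hd
  linear_combination hd

theorem isCompact_SO2 : IsCompact (SO2 : Set SL(2, ℝ)) := by
  have h : ∀ i j, Continuous fun g : SL(2, ℝ) => g.1 i j :=
    fun i j => continuous_subtype_val.matrix_elem i j
  have hcl : IsClosed (SO2 : Set SL(2, ℝ)) := by
    have : (SO2 : Set SL(2, ℝ)) = {k | k.1 0 0 = k.1 1 1} ∩ {k | k.1 0 1 = -k.1 1 0} :=
      Set.ext fun k => mem_SO2_iff
    rw [this]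
    exact (isClosed_eq (h 0 0) (h 1 1)).inter (isClosed_eq (h 0 1) (h 1 0).neg)
  refine (isCompact_norm_le 1).of_isClosed_subset hcl fun k hk i j => ?_
  have h1 := SO2_sq hk
  obtain ⟨h2, h3⟩ := mem_SO2_iff.1 hk
  rw [Real.norm_eq_abs, ← sq_le_one_iff_abs_le_one]
  fin_cases i <;> fin_cases j <;> simp only [Fin.zero_eta, Fin.mk_one]
  · nlinarith [sq_nonneg (k.1 1 0)]
  · rw [h3]; nlinarith [sq_nonneg (k.1 0 0)]
  · nlinarith [sq_nonneg (k.1 0 0)]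
  · rw [← h2]; nlinarith [sq_nonneg (k.1 1 0)]

/-- The square of the Frobenius norm of a matrix in `SL₂(ℝ)`. -/
def frob (g : SL(2, ℝ)) : ℝ := g.1 0 0 ^ 2 + g.1 0 1 ^ 2 + g.1 1 0 ^ 2 + g.1 1 1 ^ 2

/-- The square of the Frobenius distance of a matrix in `SL₂(ℝ)` from the identity. -/
def frobDist (g : SL(2, ℝ)) : ℝ :=
  (g.1 0 0 - 1) ^ 2 + g.1 0 1 ^ 2 + g.1 1 0 ^ 2 + (g.1 1 1 - 1) ^ 2

theorem frob_mul_left {k : SL(2, ℝ)} (hk : k ∈ SO2) (g : SL(2, ℝ)) : frob (k * g) = frob g := by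
  have h1 := SO2_sq hk
  obtain ⟨h2, h3⟩ := mem_SO2_iff.1 hk
  simp only [frob, mul_entry, ← h2, h3]
  linear_combination (g.1 0 0 ^ 2 + g.1 0 1 ^ 2 + g.1 1 0 ^ 2 + g.1 1 1 ^ 2) * h1

theorem frob_mul_right {k : SL(2, ℝ)} (hk : k ∈ SO2) (g : SL(2, ℝ)) : frob (g * k) = frob g := by
  have h1 := SO2_sq hk
  obtain ⟨h2, h3⟩ := mem_SO2_iff.1 hk
  simp only [frob, mul_entry, ← h2, h3]
  linear_combination (g.1 0 0 ^ 2 + g.1 0 1 ^ 2 + g.1 1 0 ^ 2 + g.1 1 1 ^ 2) * h1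

theorem frobDist_conj {k : SL(2, ℝ)} (hk : k ∈ SO2) (g : SL(2, ℝ)) :
    frobDist (k⁻¹ * g * k) = frobDist g := by
  have h : ∀ g, frobDist g = frob g - 2 * (g.1 0 0 + g.1 1 1) + 2 := fun g => by
    unfold frobDist frob; ring
  have htr : (k⁻¹ * g * k).1 0 0 + (k⁻¹ * g * k).1 1 1 = g.1 0 0 + g.1 1 1 := by
    have := Matrix.trace_mul_comm (k⁻¹ * g).1 k.1
    rw [← Matrix.SpecialLinearGroup.coe_mul, ← Matrix.SpecialLinearGroup.coe_mul,
      mul_assoc k⁻¹, ← mul_assoc k, mul_inv_cancel, one_mul, Matrix.trace_fin_two,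
      Matrix.trace_fin_two, ← mul_assoc] at this
    exact this
  rw [h, h, htr, frob_mul_right hk, frob_mul_left (inv_mem hk)]

theorem exists_frobDist_lt_imp_mem {V : Set SL(2, ℝ)} (hV : V ∈ 𝓝 1) :
    ∃ η > 0, ∀ u, frobDist u < η → u ∈ V := by
  have hn := (Matrix.SpecialLinearGroup.isClosedEmbedding_val (n := Fin 2)
    (R := ℝ)).isInducing.nhds_eq_comap (1 : SL(2, ℝ))
  obtain ⟨t, ht, htV⟩ := mem_comap.1 (hn.ge hV)
  obtain ⟨ε, hε, hb⟩ := (Metric.mem_nhds_iff (α := Fin 2 → Fin 2 → ℝ)).1 ht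
  refine ⟨ε ^ 2, by positivity, fun u hu => htV (hb ?_)⟩
  unfold frobDist at hu
  refine Metric.mem_ball.2 ((dist_pi_lt_iff hε).2 fun i => (dist_pi_lt_iff hε).2 fun j => ?_)
  change |u.1 i j - (1 : Matrix (Fin 2) (Fin 2) ℝ) i j| < ε
  refine abs_lt_of_sq_lt_sq ?_ hε.le
  fin_cases i <;> fin_cases j <;> simp <;>
    nlinarith [sq_nonneg (u.1 0 0 - 1), sq_nonneg (u.1 0 1), sq_nonneg (u.1 1 0),
      sq_nonneg (u.1 1 1 - 1)]

/-- Iwasawa decomposition, with the entries of the upper triangular factor. -/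
theorem exists_iwasawa (y : SL(2, ℝ)) : ∃ k ∈ SO2, ∃ b : SL(2, ℝ), y = k * b ∧ b.1 1 0 = 0 ∧
    0 < b.1 0 0 ∧ b.1 0 0 ^ 2 = y.1 0 0 ^ 2 + y.1 1 0 ^ 2 ∧
    b.1 0 0 * b.1 0 1 = y.1 0 0 * y.1 0 1 + y.1 1 0 * y.1 1 1 := by
  have hd := det_eq y
  have hpos : 0 < y.1 0 0 ^ 2 + y.1 1 0 ^ 2 := by
    by_contra h
    have h0 : y.1 0 0 = 0 := by nlinarith [sq_nonneg (y.1 0 0), sq_nonneg (y.1 1 0)]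
    have h1 : y.1 1 0 = 0 := by nlinarith [sq_nonneg (y.1 0 0), sq_nonneg (y.1 1 0)]
    rw [h0, h1] at hd
    simp at hd
  set r := √(y.1 0 0 ^ 2 + y.1 1 0 ^ 2)
  have hr : 0 < r := Real.sqrt_pos.2 hpos
  have hr2 : r ^ 2 = y.1 0 0 ^ 2 + y.1 1 0 ^ 2 := Real.sq_sqrt hpos.le
  have hr0 := hr.ne'
  let k : SL(2, ℝ) := mk2 (y.1 0 0 / r) (-(y.1 1 0 / r)) (y.1 1 0 / r) (y.1 0 0 / r) (by
    field_simp; linear_combination -hr2)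
  let b : SL(2, ℝ) := mk2 r ((y.1 0 0 * y.1 0 1 + y.1 1 0 * y.1 1 1) / r) 0 r⁻¹ (by
    rw [mul_zero, sub_zero, mul_inv_cancel₀ hr0])
  refine ⟨k, mem_SO2_iff.2 ⟨by simp [k], by simp [k]⟩, b, ?_, by simp [b], by simpa [b],
    by simpa [b], by simp [b]; field_simp⟩
  apply ext2 <;> rw [mul_entry] <;> simp [k, b] <;> field_simp
  · linear_combination y.1 0 1 * hr2 - y.1 1 0 * hd
  · linear_combination y.1 1 1 * hr2 + y.1 0 0 * hd

/-- Cartan decomposition. -/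
theorem exists_cartan (g : SL(2, ℝ)) : ∃ k ∈ SO2, ∃ k' ∈ SO2, ∃ a : SL(2, ℝ), g = k * a * k' ∧
    a.1 1 0 = 0 ∧ a.1 0 1 = 0 ∧ 1 ≤ a.1 0 0 := by
  have hd := det_eq g
  -- the rotation that diagonalizes the quadratic form `v ↦ |g v|²`, larger eigenvalue first
  set P := g.1 0 0 ^ 2 + g.1 1 0 ^ 2 with hP
  set Q := g.1 0 0 * g.1 0 1 + g.1 1 0 * g.1 1 1 with hQ
  set R := g.1 0 1 ^ 2 + g.1 1 1 ^ 2 with hR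
  let z : ℂ := ⟨P - R, 2 * Q⟩
  set θ := z.arg / 2 with hθ
  have hz1 : ‖z‖ * Real.cos (2 * θ) = P - R := by
    rw [hθ, mul_div_cancel₀ _ two_ne_zero]; exact Complex.norm_mul_cos_arg z
  have hz2 : ‖z‖ * Real.sin (2 * θ) = 2 * Q := by
    rw [hθ, mul_div_cancel₀ _ two_ne_zero]; exact Complex.norm_mul_sin_arg z
  have hcs := Real.sin_sq_add_cos_sq θ
  rw [Real.cos_two_mul'] at hz1
  rw [Real.sin_two_mul] at hz2
  set c := Real.cos θ
  set s := Real.sin θ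
  let κ : SL(2, ℝ) := mk2 c (-s) s c (by linear_combination hcs)
  have hκ : κ ∈ SO2 := mem_SO2_iff.2 ⟨by simp [κ], by simp [κ]⟩
  obtain ⟨k, hk, a, ha, h10, h00, hsq, h01⟩ := exists_iwasawa (g * κ)
  refine ⟨k, hk, κ⁻¹, inv_mem hκ, a, by rw [← ha, mul_inv_cancel_right], h10, ?_, ?_⟩
  · have h1 : a.1 0 0 * a.1 0 1 = 0 := by
      rw [h01]
      simp only [mul_entry]
      simp [κ]
      linear_combination (c ^ 2 - s ^ 2) * (- hQ) + s * c * (hP - hR) -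
        (c ^ 2 - s ^ 2) / 2 * hz2 + s * c * hz1
    exact (mul_eq_zero.1 h1).resolve_left h00.ne'
  · have h1 : a.1 0 0 ^ 2 = (P + R) / 2 + ‖z‖ / 2 := by
      rw [hsq]
      simp only [mul_entry]
      simp [κ]
      linear_combination -c ^ 2 * hP - 2 * c * s * hQ - s ^ 2 * hR -
        (c ^ 2 - s ^ 2) / 2 * hz1 - s * c * hz2 +
        ((P + R) / 2 + ‖z‖ / 2 * (c ^ 2 + s ^ 2 + 1)) * hcs
    have h2 : P * R - Q ^ 2 = 1 := by
      rw [hP, hQ, hR]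
      linear_combination (g.1 0 0 * g.1 1 1 - g.1 0 1 * g.1 1 0 + 1) * hd
    have h3 : 2 ≤ P + R := by
      have : 0 ≤ P := by positivity
      have : 0 ≤ R := by positivity
      nlinarith [sq_nonneg (P - R), sq_nonneg Q]
    nlinarith [norm_nonneg z]

end Rotations

/-! ### The wavefront property -/

section Wavefront

variable {S : Finset Nat.Primes}

theorem isCompact_H (S : Finset Nat.Primes) : IsCompact (H S : Set (G S)) := by
  have : (H S : Set (G S)) = (SO2 : Set SL(2, ℝ)) ×ˢ Set.pi Set.univ fun p : S =>
      (SLZp p.1.1 : Set SL(2, ℚ_[p.1.1])) := rfl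
  rw [this]
  exact isCompact_SO2.prod (isCompact_univ_pi fun p => isCompact_SLZp p.1.1)

instance compactSpace_H : CompactSpace (H S) := isCompact_iff_compactSpace.1 (isCompact_H S)

/-- A left `H`-invariant neighbourhood of `H` in `G`: the elements that are integral at the primes
in `S` and whose real component has Frobenius norm close to that of a rotation. -/
def thickening (S : Finset Nat.Primes) (δ : ℝ) : Set (G S) :=
  {x | x ∈ integral S ∧ frob x.1 < 2 + δ}

theorem continuous_frob : Continuous frob := by
  have h : ∀ i j, Continuous fun g : SL(2, ℝ) => g.1 i j :=
    fun i j => continuous_subtype_val.matrix_elem i j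
  exact ((((h 0 0).pow 2).add ((h 0 1).pow 2)).add ((h 1 0).pow 2)).add ((h 1 1).pow 2)

theorem isOpen_thickening (δ : ℝ) : IsOpen (thickening S δ) :=
  isOpen_integral.inter (isOpen_lt (continuous_frob.comp continuous_fst) continuous_const)

theorem one_mem_thickening {δ : ℝ} (hδ : 0 < δ) : (1 : G S) ∈ thickening S δ := by
  refine ⟨fun p => one_mem _, ?_⟩
  have : frob 1 = 2 := by simp [frob]; norm_num
  change frob 1 < _
  linarith

theorem exists_compact_thickening (δ : ℝ) :
    ∃ K : Set (G S), IsCompact K ∧ thickening S δ ⊆ K := by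
  obtain ⟨K, hK, h⟩ := exists_compact_of_bounded (S := S) (3 + δ)
  refine ⟨K, hK, fun x ⟨hx, hlt⟩ => h x hx fun i j => ?_⟩
  unfold frob at hlt
  have h1 : x.1.1 i j ^ 2 < 2 + δ := by
    fin_cases i <;> fin_cases j <;> simp only [Fin.zero_eta, Fin.mk_one] <;>
      nlinarith [sq_nonneg (x.1.1 0 0), sq_nonneg (x.1.1 0 1), sq_nonneg (x.1.1 1 0),
        sq_nonneg (x.1.1 1 1)]
  nlinarith [sq_nonneg (|x.1.1 i j| - 1), sq_abs (x.1.1 i j)]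

theorem mul_mem_thickening_iff {δ : ℝ} {h : G S} (hh : h ∈ H S) (x : G S) :
    h * x ∈ thickening S δ ↔ x ∈ thickening S δ := by
  have h1 : h.1 ∈ SO2 := hh.1
  have h2 : ∀ p, h.2 p ∈ SLZp p.1.1 := fun p => hh.2 p trivial
  refine and_congr (forall_congr' fun p => (SLZp p.1.1).mul_mem_cancel_left (h2 p)) ?_
  rw [Prod.fst_mul, frob_mul_left h1]

/-- The wavefront property: `O g ⊆ H g V` for a small thickening `O` of `H`, uniformly in `g`. If
`g = k a k'` in Cartan form and `x k = h b` in Iwasawa form, then `x g = (h k⁻¹) g v` where `v` is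
the conjugate by `k'` of `a⁻¹ b a`, and conjugation by `a⁻¹` contracts upper triangular matrices. -/
theorem exists_wavefront {V : Set (G S)} (hV : V ∈ 𝓝 1) : ∃ δ > 0, ∀ g : G S,
    ∀ x ∈ thickening S δ, ∃ h ∈ H S, ∃ v ∈ V, x * g = h * (g * v) := by
  have hV' : inclReal S ⁻¹' V ∈ 𝓝 1 :=
    continuous_inclReal.continuousAt (by rwa [map_one])
  obtain ⟨η, hη, hmem⟩ := exists_frobDist_lt_imp_mem hV'
  refine ⟨η / 2, by positivity, fun g x ⟨hxi, hx⟩ => ?_⟩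
  obtain ⟨κ, hκ, κ', hκ', a, hg, ha10, ha01, ha00⟩ := exists_cartan g.1
  obtain ⟨h, hh, b, hb, hb10, hb00, -, -⟩ := exists_iwasawa (x.1 * κ)
  let u : SL(2, ℝ) := κ'⁻¹ * (a⁻¹ * b * a) * κ'
  have hu : frobDist u < η := by
    have h1 : frob b < 2 + η / 2 := by
      rwa [← frob_mul_left hh, ← hb, frob_mul_right hκ]
    rw [frobDist_conj hκ']
    have hda := det_eq a
    have hdb := det_eq b
    rw [ha10, mul_zero, sub_zero] at hda
    rw [hb10, mul_zero, sub_zero] at hdb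
    have hi : ∀ i j, (a⁻¹).1 i j = (!![a.1 1 1, -a.1 0 1; -a.1 1 0, a.1 0 0] : Matrix _ _ ℝ) i j :=
      fun i j => by rw [Matrix.SpecialLinearGroup.SL2_inv_expl]; rfl
    have e00 : (a⁻¹ * b * a).1 0 0 = b.1 0 0 := by
      simp only [mul_entry, hi]; simp [ha10, ha01, hb10]; linear_combination b.1 0 0 * hda
    have e11 : (a⁻¹ * b * a).1 1 1 = b.1 1 1 := by
      simp only [mul_entry, hi]; simp [ha10, ha01, hb10]; linear_combination b.1 1 1 * hda
    have e10 : (a⁻¹ * b * a).1 1 0 = 0 := by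
      simp only [mul_entry, hi]; simp [ha10, hb10]
    have e01 : (a⁻¹ * b * a).1 0 1 = a.1 1 1 ^ 2 * b.1 0 1 := by
      simp only [mul_entry, hi]; simp [ha10, ha01, hb10]; ring
    have ha11 : a.1 1 1 ^ 2 ≤ 1 := by
      have : 0 < a.1 1 1 := by by_contra!; nlinarith
      have : a.1 1 1 ≤ 1 := by nlinarith
      nlinarith
    have hb11 : 0 < b.1 1 1 := by by_contra!; nlinarith
    have h2 : (a.1 1 1 ^ 2 * b.1 0 1) ^ 2 ≤ b.1 0 1 ^ 2 := by
      rw [mul_pow]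
      refine mul_le_of_le_one_left (sq_nonneg _) ?_
      exact pow_le_one₀ (sq_nonneg _) ha11
    have hsq : ∀ r s : ℝ, 0 < r → 0 < s → r * s = 1 → (r - 1) ^ 2 ≤ (r - s) ^ 2 :=
      fun r s hr hs hrs => by
        obtain h | h := le_total 1 r
        · have : s ≤ 1 := by nlinarith
          nlinarith
        · have : 1 ≤ s := by nlinarith
          nlinarith
    have h3 := hsq _ _ hb00 hb11 hdb
    have h4 := hsq _ _ hb11 hb00 (by rw [mul_comm, hdb])
    unfold frob at h1
    unfold frobDist
    rw [e00, e11, e10, e01]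
    rw [hb10] at h1
    nlinarith
  refine ⟨(h * κ⁻¹, x.2), ⟨SO2.mul_mem hh (SO2.inv_mem hκ), fun p _ => hxi p⟩, inclReal S u,
    hmem u hu, ?_⟩
  have h1 : x.1 * g.1 = h * κ⁻¹ * (g.1 * u) := by
    have : x.1 = h * b * κ⁻¹ := by rw [← hb, mul_inv_cancel_right]
    rw [hg, this]
    simp only [u]
    group
  refine Prod.ext h1 ?_
  change x.2 * g.2 = x.2 * (g.2 * 1)
  rw [mul_one]

end Wavefront

/-! ### Equidistribution of translated `H`-orbits -/

section Counting

variable {S : Finset Nat.Primes} [MeasurableSpace (G S)] [BorelSpace (G S)] (μG : Measure (G S))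
  [μG.IsHaarMeasure] (μX : Measure (X S)) [QuotientMeasureEqMeasurePreimage μG μX]

theorem exists_abs_le (α : C_c(X S, ℝ)) : ∃ C, ∀ x, |α x| ≤ C :=
  α.hasCompactSupport.exists_bound_of_continuous α.continuous

theorem continuous_comp_proj (α : C_c(X S, ℝ)) : Continuous fun g => α (proj (Gam S) g) :=
  α.continuous.comp (continuous_proj (Gam S))

theorem exists_rightInvariant_probability (S : Finset Nat.Primes) [MeasurableSpace (G S)]
    [BorelSpace (G S)] : ∃ ν : Measure (H S), IsProbabilityMeasure ν ∧ ν.IsMulRightInvariant := by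
  let ν₀ : Measure (H S) := Measure.haarMeasure ⊤
  have h0 : IsProbabilityMeasure ν₀ := ⟨by
    simpa using Measure.haarMeasure_self (K₀ := (⊤ : TopologicalSpace.PositiveCompacts (H S)))⟩
  exact ⟨ν₀.inv, Measure.isProbabilityMeasure_map measurable_inv.aemeasurable, inferInstance⟩

/-- The averages of `α` over `Γ \ Γ H g` tend to the mean of `α` as `g` leaves every compact set. -/
theorem tendsto_avg [μG.IsMulRightInvariant] [IsFiniteMeasure μX] (ν : Measure (H S))
    [IsProbabilityMeasure ν] [ν.IsMulRightInvariant] (α : C_c(X S, ℝ)) :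
    Tendsto (avg ν fun g => α (proj (Gam S) g)) (cocompact (G S))
      (𝓝 ((∫ x, α x ∂μX) / μX.real Set.univ)) := by
  obtain ⟨C, hC⟩ := exists_abs_le α
  have hα := continuous_comp_proj α
  have hαC : ∀ g, |α (proj (Gam S) g)| ≤ C := fun g => hC _
  set m : ℝ := (∫ x, α x ∂μX) / μX.real Set.univ
  rw [Metric.tendsto_nhds]
  intro ε hε
  have hV := eventually_abs_rightTranslate_sub_lt α (half_pos (half_pos hε))
  obtain ⟨δ, hδ, hwave⟩ := exists_wavefront hV
  obtain ⟨K, hK, hOK⟩ := exists_compact_thickening (S := S) δ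
  set O := thickening S δ
  have hO : MeasurableSet O := (isOpen_thickening δ).measurableSet
  have hOfin : μG O ≠ ⊤ := ((measure_mono hOK).trans_lt hK.measure_lt_top).ne
  have hO0 : 0 < μG.real O := ENNReal.toReal_pos
    ((isOpen_thickening δ).measure_pos μG ⟨1, one_mem_thickening hδ⟩).ne' hOfin
  have : IsFiniteMeasure (μG.restrict O) := ⟨by simpa using hOfin.lt_top⟩
  -- the average at `x g` is close to the average at `g`, for `x` in the thickening
  have hclose : ∀ g, ∀ x ∈ O, |avg ν (fun g => α (proj (Gam S) g)) (x * g) -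
      avg ν (fun g => α (proj (Gam S) g)) g| ≤ ε / 2 / 2 := fun g x hx => by
    obtain ⟨h, hh, v, hv, hxg⟩ := hwave g x hx
    rw [hxg, avg_mul_left ν _ ⟨h, hh⟩]
    refine abs_avg_sub_avg_le ν hα hαC fun l => ?_
    rw [← mul_assoc]
    exact (hv (proj (Gam S) (l * g))).le
  have hint : ∀ g, ∫ x in O, avg ν (fun g => α (proj (Gam S) g)) (x * g) ∂μG =
      ∫ x in O, α (proj (Gam S) (x * g)) ∂μG := fun g => by
    have h1 := integral_mul_avg ν (μ := μG) (f := fun x => α (proj (Gam S) (x * g)))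
      (hα.comp (continuous_mul_const g)) (fun x => hC _) (φ := O.indicator 1)
      ((integrable_indicator_iff hO).2 (integrableOn_const hOfin)) fun h hh x => by
        have h2 : h * x ∈ O ↔ x ∈ O := mul_mem_thickening_iff hh x
        by_cases hx : x ∈ O
        · rw [Set.indicator_of_mem hx, Set.indicator_of_mem (h2.2 hx)]; rfl
        · rw [Set.indicator_of_notMem hx, Set.indicator_of_notMem (mt h2.1 hx)]
    have h3 : ∀ f : G S → ℝ, ∫ x, O.indicator 1 x * f x ∂μG = ∫ x in O, f x ∂μG := fun f => by
      rw [← integral_indicator hO]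
      refine integral_congr_ae (ae_of_all _ fun x => ?_)
      by_cases hx : x ∈ O <;> simp [hx]
    rw [h3, h3] at h1
    rw [← h1]
    simp only [avg, mul_assoc]
  have hlim := (Metric.tendsto_nhds.1 (tendsto_setIntegral_translate μG μX hO hK hOK α))
    (ε / 2 * μG.real O) (by positivity)
  filter_upwards [hlim] with g hg
  rw [Real.dist_eq] at hg ⊢
  have hi : Integrable (fun x => avg ν (fun g => α (proj (Gam S) g)) (x * g)) (μG.restrict O) :=
    .of_bound ((stronglyMeasurable_avg ν hα).comp_measurable
      (measurable_mul_const g)).aestronglyMeasurable C (ae_of_all _ fun x => abs_avg_le ν hαC _)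
  have h1 : |∫ x in O, α (proj (Gam S) (x * g)) ∂μG -
      avg ν (fun g => α (proj (Gam S) g)) g * μG.real O| ≤ ε / 2 / 2 * μG.real O := by
    have h2 : avg ν (fun g => α (proj (Gam S) g)) g * μG.real O =
        ∫ _ in O, avg ν (fun g => α (proj (Gam S) g)) g ∂μG := by simp [mul_comm]
    rw [← hint, h2, ← integral_sub hi (integrable_const _)]
    exact norm_setIntegral_le_of_norm_le_const (f := fun x =>
      avg ν (fun g => α (proj (Gam S) g)) (x * g) - avg ν (fun g => α (proj (Gam S) g)) g)
      hOfin.lt_top (hclose g)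
  refine lt_of_mul_lt_mul_right ?_ hO0.le
  rw [← abs_of_pos hO0, ← abs_mul, abs_of_pos hO0, sub_mul]
  rw [abs_lt] at hg ⊢
  rw [abs_le] at h1
  have h5 : 0 < ε * μG.real O := by positivity
  constructor <;> linarith [hg.1, hg.2, h1.1, h1.2]

end Counting

end SArith

namespace SArith

open HoweMoore LatticeQuotient

/-! ### Weighted means -/

/-- Weighted means of a bounded function that converges at infinity, for uniformly bounded weights
of total mass tending to infinity, converge to the limit of the function. -/
theorem tendsto_weighted_mean {Y : Type*} [TopologicalSpace Y] [R1Space Y] [MeasurableSpace Y]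
    [BorelSpace Y] {μ : Measure Y} [IsFiniteMeasureOnCompacts μ] {A : Y → ℝ}
    (hA : StronglyMeasurable A) {C m : ℝ} (hC : ∀ y, |A y| ≤ C)
    (hm : Tendsto A (cocompact Y) (𝓝 m)) {φ : ℕ → Y → ℝ} (h0 : ∀ n y, 0 ≤ φ n y)
    (hφ : ∀ n, Integrable (φ n) μ) {B : ℝ} (hB : ∀ n, ∀ᵐ y ∂μ, φ n y ≤ B)
    (hlim : Tendsto (fun n => ∫ y, φ n y ∂μ) atTop atTop) :
    Tendsto (fun n => (∫ y, φ n y * A y ∂μ) / ∫ y, φ n y ∂μ) atTop (𝓝 m) := by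
  rw [Metric.tendsto_nhds]
  intro ε hε
  obtain ⟨K₀, hK₀, hsub⟩ := mem_cocompact.1 (Metric.tendsto_nhds.1 hm (ε / 2) (half_pos hε))
  -- a measurable compact set outside of which `A` is close to `m`
  set K := closure K₀
  have hK : IsCompact K := hK₀.closure
  have hKm : MeasurableSet K := isClosed_closure.measurableSet
  have hKfin : μ K ≠ ⊤ := hK.measure_lt_top.ne
  set M : ℝ := |B| * (C + |m|)
  have hi : ∀ n, Integrable (fun y => φ n y * A y) μ := fun n =>
    (hφ n).mul_bdd hA.aestronglyMeasurable (ae_of_all _ hC)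
  have hbound : ∀ n, |∫ y, φ n y * A y ∂μ - m * ∫ y, φ n y ∂μ| ≤
      ε / 2 * ∫ y, φ n y ∂μ + M * μ.real K := fun n => by
    have hK1 : Integrable (K.indicator fun _ => M) μ :=
      (integrable_indicator_iff hKm).2 (integrableOn_const (C := M) hKfin)
    have h1 : ∫ y, (ε / 2 * φ n y + K.indicator (fun _ => M) y) ∂μ =
        ε / 2 * ∫ y, φ n y ∂μ + M * μ.real K := by
      rw [integral_add ((hφ n).const_mul _) hK1, integral_const_mul, integral_indicator hKm,
        setIntegral_const, smul_eq_mul, mul_comm M]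
    rw [← integral_const_mul, ← integral_sub (hi n) ((hφ n).const_mul m), ← h1,
      ← Real.norm_eq_abs]
    refine norm_integral_le_of_norm_le (((hφ n).const_mul _).add hK1) ?_
    filter_upwards [hB n] with y hy
    have h2 : φ n y * A y - m * φ n y = φ n y * (A y - m) := by ring
    rw [h2, Real.norm_eq_abs, abs_mul, abs_of_nonneg (h0 n y)]
    by_cases hyK : y ∈ K
    · rw [Set.indicator_of_mem hyK]
      have h3 : φ n y * |A y - m| ≤ M := by
        have h4 : |A y - m| ≤ C + |m| := (abs_sub _ _).trans (by gcongr; exact hC y)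
        exact mul_le_mul (hy.trans (le_abs_self B)) h4 (abs_nonneg _) (abs_nonneg _)
      have h5 : 0 ≤ ε / 2 * φ n y := mul_nonneg (half_pos hε).le (h0 n y)
      linarith
    · rw [Set.indicator_of_notMem hyK, add_zero, mul_comm]
      have h3 : dist (A y) m < ε / 2 := hsub fun h => hyK (subset_closure h)
      exact mul_le_mul_of_nonneg_right h3.le (h0 n y)
  filter_upwards [hlim.eventually_gt_atTop 0, hlim.eventually_gt_atTop (M * μ.real K / (ε / 2))]
    with n hn0 hn
  rw [div_lt_iff₀ (half_pos hε)] at hn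
  rw [Real.dist_eq, ← mul_div_cancel_right₀ m hn0.ne', ← sub_div, abs_div, abs_of_pos hn0,
    div_lt_iff₀ hn0]
  have := hbound n
  linarith

theorem ae_le_toReal_iSup_eLpNorm {Y : Type*} [MeasurableSpace Y] {μ : Measure Y}
    {φ : ℕ → Y → ℝ} (h : (⨆ n, eLpNorm (φ n) ⊤ μ) < ⊤) (n : ℕ) :
    ∀ᵐ y ∂μ, φ n y ≤ (⨆ n, eLpNorm (φ n) ⊤ μ).toReal := by
  filter_upwards [enorm_ae_le_eLpNormEssSup (φ n) μ] with y hy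
  rw [← eLpNorm_exponent_top] at hy
  have h1 := ENNReal.toReal_mono h.ne (hy.trans (le_iSup (fun n => eLpNorm (φ n) ⊤ μ) n))
  rw [toReal_enorm] at h1
  exact (Real.le_norm_self _).trans h1

end SArith

end

theorem mainTheorem7 (S : Finset Nat.Primes)
    [MeasurableSpace (SArith.G S)] [BorelSpace (SArith.G S)]
    (μG : Measure (SArith.G S)) [μG.IsHaarMeasure]
    (μX : Measure (SArith.X S)) [QuotientMeasureEqMeasurePreimage μG μX]
    (φ : ℕ → SArith.G S → ℝ)
    (hφ_nonneg : ∀ n g, 0 ≤ φ n g)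
    (hφ_int : ∀ n, Integrable (φ n) μG)
    (hφ_supp : ∀ n, HasCompactSupport (φ n))
    (hφ_bdd : (⨆ n, eLpNorm (φ n) ⊤ μG) < ⊤)
    (hφ_lim : Tendsto (fun n => ∫ g, φ n g ∂μG) atTop atTop)
    (hφ_inv : ∀ n, ∀ h ∈ SArith.H S, ∀ g, φ n (h * g) = φ n g) :
    0 < μX Set.univ ∧ μX Set.univ < ⊤ ∧
      SArith.ConvergesWeakly μX
        (fun n x => SArith.F S (φ n) x / ((∫ g, φ n g ∂μG) / μX.real Set.univ))
        (fun _ => 1) := by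
  have hfin := SArith.measure_univ_lt_top μG μX
  have : IsFiniteMeasure μX := ⟨hfin⟩
  have : μG.IsMulRightInvariant := LatticeQuotient.isMulRightInvariant_of_finite μG μX hfin.ne
  have h0 := LatticeQuotient.measure_univ_ne_zero μG μX
  refine ⟨h0.bot_lt, hfin, fun α => ?_⟩
  obtain ⟨C, hC⟩ := SArith.exists_abs_le α
  have hαm : Measurable α := α.continuous.measurable
  have hV : μX.real Set.univ ≠ 0 := (ENNReal.toReal_pos h0 hfin.ne).ne'
  have hunf := fun n => LatticeQuotient.unfolding μG μX (hφ_int n) (hφ_nonneg n) hαm hC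
  -- this holds also when `∫ φ n = 0`, with both sides zero
  have hrw : ∀ n x, SArith.F S (φ n) x / ((∫ g, φ n g ∂μG) / μX.real Set.univ) * α x =
      μX.real Set.univ / (∫ g, φ n g ∂μG) * (MulAction.automorphize (φ n) x * α x) :=
    fun n x => by
      rw [div_div_eq_mul_div]
      change MulAction.automorphize (φ n) x * _ / _ * _ = _
      ring
  simp only [hrw, one_mul]
  refine ⟨fun n => (hunf n).1.const_mul _,
    .of_bound hαm.aestronglyMeasurable C (ae_of_all _ hC), ?_⟩
  obtain ⟨ν, hν, hν'⟩ := SArith.exists_rightInvariant_probability S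
  have hcont := SArith.continuous_comp_proj α
  have key := SArith.tendsto_weighted_mean (μ := μG)
    (LatticeQuotient.stronglyMeasurable_avg ν hcont)
    (LatticeQuotient.abs_avg_le ν fun g => hC _) (SArith.tendsto_avg μG μX ν α) hφ_nonneg hφ_int
    (SArith.ae_le_toReal_iSup_eLpNorm hφ_bdd) hφ_lim
  have hlim := key.const_mul (μX.real Set.univ)
  rw [mul_div_cancel₀ _ hV] at hlim
  refine hlim.congr fun n => ?_
  rw [integral_const_mul, (hunf n).2,
    LatticeQuotient.integral_mul_avg ν hcont (fun g => hC _) (hφ_int n) (hφ_inv n)]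
  ring
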